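/- Let $0<H\le 1$ and $\sigma\in\mathbb R$. A fractional Brownian motion $B_H=\{B_H(t)\}_{t\in\mathbb R}$ with Hurst parameter $H$ is an almost surely continuous centred Gaussian process with $\mathbb E(B_H(t)B_H(s))=\tfrac12\left(|t|^{2H}+|s|^{2H}-|t-s|^{2H}\right)$. For $\lambda>0$ put $T_\lambda(y)(t)=\int_{-\infty}^t e^{-\lambda(t-s)}\,dy(s)$ (an improper Riemann–Stieltjes integral, taken path by path). For distinct $\lambda_1,\dots,\lambda_q>0$ and integers $p_1,\dots,p_q\ge1$, write $X\sim\mathrm{FOU}(\lambda_1^{(p_1)},\dots,\lambda_q^{(p_q)},\sigma,H)$ if $X=T_{\lambda_1}^{p_1}\circ\cdots\circ T_{\lambda_q}^{p_q}(\sigma B_H)$ almost surely for some fractional Brownian motion $B_H$ with Hurst parameter $H$; exponents $p_i=1$ are omitted. For $x\ge0$ let $$f_H(x)=e^{-x}\Big(\Gamma(2H)-\int_0^x e^{s}s^{2H-1}ds\Big)+e^{x}\Big(\Gamma(2H)-\int_0^x e^{-s}s^{2H-1}ds\Big).$$ Then $f_H$ is twice continuously differentiable on $(0,\infty)$. In each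 case below $X$ is centred and square integrable, and for all $s\in\mathbb R$ and $t\ge0$ one has $\mathbb E(X_sX_{s+t})=R(t)$ (in particular $\mathbb E(X_0X_t)=R(t)$), where terms containing the factor $t\,f_H'(\alpha t)$ or $t^2f_H''(\alpha t)$ are read as $0$ at $t=0$. 1. If $X\sim\mathrm{FOU}(\alpha,\beta,\gamma,\sigma,H)$ with $\alpha,\beta,\gamma$ pairwise distinct, then $$R(t)=\frac{\sigma^2H}{2}\left[\frac{\alpha^{4-2H}f_H(\alpha t)}{(\alpha^2-\beta^2)(\alpha^2-\gamma^2)}+\frac{\beta^{4-2H}f_H(\beta t)}{(\beta^2-\alpha^2)(\beta^2-\gamma^2)}+\frac{\gamma^{4-2H}f_H(\gamma t)}{(\gamma^2-\alpha^2)(\gamma^2-\beta^2)}\right].$$ 2. If $X\sim\mathrm{FOU}(\alpha^{(2)},\beta,\sigma,H)$ with $\alpha\ne\beta$, then $$R(t)=\frac{\sigma^2H}{2}\cdot\frac{\beta^{4-2H}f_H(\beta t)-\alpha^{4-2H}f_H(\alpha t)+\Big((2-H)\alpha^{2-2H}f_H(\alpha t)+\frac{\alpha^{3-2H}t f_H'(\alpha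 t)}{2}\Big)(\alpha^2-\beta^2)}{(\alpha^2-\beta^2)^2}.$$ 3. If $X\sim\mathrm{FOU}(\alpha^{(3)},\sigma,H)$, then $$R(t)=\frac{\sigma^2H}{4\alpha^{2H}}\left[(2-H)(1-H)f_H(\alpha t)+(7-4H)\frac{\alpha t}{4}f_H'(\alpha t)+\frac{\alpha^2t^2}{4}f_H''(\alpha t)\right].$$ Moreover, for each $t\ge0$ and distinct $\alpha,\beta>0$, the right-hand side in 2 is the limit of the right-hand side in 1 as $\gamma\to\alpha$, and for each $t\ge0$ and $\alpha>0$ the right-hand side in 3 is the limit of the right-hand side in 2 as $\beta\to\alpha$. -/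

import Mathlib

open MeasureTheory ProbabilityTheory Filter Topology

/-- `B` is a (two-sided, standard) fractional Brownian motion with Hurst parameter `H ∈ (0, 1]`:
an almost surely continuous centred Gaussian process indexed by `ℝ` with covariance
`(|t|^{2H} + |s|^{2H} - |t - s|^{2H}) / 2`. -/
structure IsFBM {Ω : Type*} [MeasurableSpace Ω] (P : Measure Ω) (H : ℝ) (B : ℝ → Ω → ℝ) :
    Prop where
  hurst_pos : 0 < H
  hurst_le_one : H ≤ 1
  gaussian : IsGaussianProcess B P
  continuous_paths : ∀ᵐ ω ∂P, Continuous fun t => B t ω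
  centred : ∀ t, ∫ ω, B t ω ∂P = 0
  covariance : ∀ t s, ∫ ω, B t ω * B s ω ∂P =
    (1 / 2) * (|t| ^ (2 * H) + |s| ^ (2 * H) - |t - s| ^ (2 * H))

/-- `I` is the Riemann–Stieltjes integral `∫_a^b f(u) dy(u)`: the limit of the tagged sums
`∑ f(ξ_i) (y(u_{i+1}) - y(u_i))` over partitions `a = u_0 ≤ u_1 ≤ ⋯ ≤ u_n = b` with tags
`ξ_i ∈ [u_i, u_{i+1}]`, as the mesh tends to zero. -/
def HasRSIntegral (f y : ℝ → ℝ) (a b I : ℝ) : Prop :=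
  ∀ ε > 0, ∃ δ > 0, ∀ (n : ℕ) (u ξ : ℕ → ℝ), u 0 = a → u n = b →
    (∀ i < n, u i ≤ ξ i ∧ ξ i ≤ u (i + 1) ∧ u (i + 1) - u i < δ) →
    |∑ i ∈ Finset.range n, f (ξ i) * (y (u (i + 1)) - y (u i)) - I| < ε

/-- `I` is the improper Riemann–Stieltjes integral
`T_r(y)(t) = ∫_{-∞}^t e^{-r (t - s)} dy(s) = lim_{a → -∞} ∫_a^t e^{-r (t - s)} dy(s)`. -/
def HasOUIntegral (r : ℝ) (y : ℝ → ℝ) (t I : ℝ) : Prop :=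
  ∃ F : ℝ → ℝ, (∀ a ≤ t, HasRSIntegral (fun s => Real.exp (-r * (t - s))) y a t (F a)) ∧
    Tendsto F atBot (𝓝 I)

/-- `x = (T_{r_1} ∘ T_{r_2} ∘ ⋯ ∘ T_{r_p})(y)` as functions on `ℝ`, for a list `[r_1, …, r_p]`
(all the integrals involved being convergent). -/
def IsIteratedOU : List ℝ → (ℝ → ℝ) → (ℝ → ℝ) → Prop
  | [], y, x => x = y
  | r :: rs, y, x => ∃ z : ℝ → ℝ, IsIteratedOU rs y z ∧ ∀ t, HasOUIntegral r z t (x t)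

/-- `X ∼ FOU(r_1^{(p_1)}, …, r_q^{(p_q)}, σ, H)`, for the list `[(r_1, p_1), …, (r_q, p_q)]` of
distinct positive rates with multiplicities `p_i ≥ 1`: for some fractional Brownian motion `B` with
Hurst parameter `H`, almost every path of `X` is
`(T_{r_1}^{p_1} ∘ ⋯ ∘ T_{r_q}^{p_q})(σ B)`. -/
structure IsFOU {Ω : Type*} [MeasurableSpace Ω] (P : Measure Ω) (rates : List (ℝ × ℕ))
    (σ H : ℝ) (X : ℝ → Ω → ℝ) : Prop where
  rates_pos : ∀ q ∈ rates, 0 < q.1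
  mult_pos : ∀ q ∈ rates, 1 ≤ q.2
  distinct : (rates.map Prod.fst).Nodup
  exists_fbm : ∃ B : ℝ → Ω → ℝ, IsFBM P H B ∧ ∀ᵐ ω ∂P,
    IsIteratedOU (rates.flatMap fun q => List.replicate q.2 q.1)
      (fun s => σ * B s ω) (fun t => X t ω)

/-- `X` is a centred square-integrable process with
`E(X_s X_{s+t}) = R(t)` for all `s ∈ ℝ` and `t ≥ 0` (in particular `E(X_0 X_t) = R(t)`). -/
def HasAutocovariance {Ω : Type*} [MeasurableSpace Ω] (P : Measure Ω) (X : ℝ → Ω → ℝ)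
    (R : ℝ → ℝ) : Prop :=
  (∀ s, MemLp (X s) 2 P) ∧ (∀ s, ∫ ω, X s ω ∂P = 0) ∧
    ∀ s t, 0 ≤ t → ∫ ω, X s ω * X (s + t) ω ∂P = R t

/-- `f_H(x) = e^{-x} (Γ(2H) - ∫_0^x e^s s^{2H-1} ds) + e^x (Γ(2H) - ∫_0^x e^{-s} s^{2H-1} ds)`,
for `x ≥ 0`. -/
noncomputable def fH (H x : ℝ) : ℝ :=
  Real.exp (-x) *
      (Real.Gamma (2 * H) - ∫ s in (0 : ℝ)..x, Real.exp s * s ^ (2 * H - 1)) +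
    Real.exp x *
      (Real.Gamma (2 * H) - ∫ s in (0 : ℝ)..x, Real.exp (-s) * s ^ (2 * H - 1))

/-- The autocovariance formula for three distinct rates `α`, `β`, `γ`. -/
noncomputable def autocovDistinct (α β γ σ H t : ℝ) : ℝ :=
  σ ^ 2 * H / 2 *
    (α ^ (4 - 2 * H) * fH H (α * t) / ((α ^ 2 - β ^ 2) * (α ^ 2 - γ ^ 2)) +
      β ^ (4 - 2 * H) * fH H (β * t) / ((β ^ 2 - α ^ 2) * (β ^ 2 - γ ^ 2)) +
      γ ^ (4 - 2 * H) * fH H (γ * t) / ((γ ^ 2 - α ^ 2) * (γ ^ 2 - β ^ 2)))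

/-- The autocovariance formula for a double rate `α` and a simple rate `β`. -/
noncomputable def autocovDouble (α β σ H t : ℝ) : ℝ :=
  σ ^ 2 * H / 2 *
    ((β ^ (4 - 2 * H) * fH H (β * t) - α ^ (4 - 2 * H) * fH H (α * t) +
        ((2 - H) * α ^ (2 - 2 * H) * fH H (α * t) +
            α ^ (3 - 2 * H) * t * deriv (fH H) (α * t) / 2) * (α ^ 2 - β ^ 2)) /
      (α ^ 2 - β ^ 2) ^ 2)

/-- The autocovariance formula for a triple rate `α`. -/
noncomputable def autocovTriple (α σ H t : ℝ) : ℝ :=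
  σ ^ 2 * H / (4 * α ^ (2 * H)) *
    ((2 - H) * (1 - H) * fH H (α * t) +
      (7 - 4 * H) * (α * t / 4) * deriv (fH H) (α * t) +
      α ^ 2 * t ^ 2 / 4 * deriv (deriv (fH H)) (α * t))

/-! Integration by parts turns `T_a` into `1 - A_a`, where `A_a y (t)` is the mean of `y (t - u)`
for `u` exponential of rate `a` (`HasOUIntegral.eq_ouTransform`). Almost every path of fractional
Brownian motion lies in a class (`Tame`) on which this is legitimate and which every `T_a`
preserves.

Since `A_b y` solves `z' = b (y - z)`, there is a resolvent identity `(a - b) T_a T_b = a T_a - b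
T_b`. Hence for distinct rates `T_a T_b T_c` is a linear combination of `T_a`, `T_b`, `T_c`, and
only the cross-covariances of `T_a B` and `T_b B` are needed. Writing `T_a B` as a mean of
increments and using Fubini, these reduce to exponential means of `|x|^{2H}` taken to the left and
to the right of the lag (`integral_ouTransform_mul`). The sum of the two means is `2 |τ|^{2H}` plus
a multiple of `f_H (a τ)` (`expAvg_add_reflected_abs_rpow`); in the symmetric double sum only these
sums survive and the powers cancel (`double_sum_partial_fractions`).

Repeated rates follow by continuity. The covariances of `T_γ Z` are continuous in `γ`
(`tendsto_integral_ouTransform_mul`), while the formulas are divided differences of `x^{4-2H} f_H (x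
t)` in the variable `x²`, whose confluent limits are computed by calculus
(`tendsto_autocovDistinct`, `tendsto_autocovDouble`). -/

/-! ### Integrals against the exponential law. -/

theorem integral_expMeasure {a : ℝ} (ha : 0 < a) (f : ℝ → ℝ) :
    ∫ u, f u ∂expMeasure a = ∫ u in Set.Ioi (0 : ℝ), a * Real.exp (-a * u) * f u := by
  have h1 : expMeasure a = volume.withDensity (exponentialPDF a) := rfl
  rw [h1, integral_withDensity_eq_integral_toReal_smul
    (f := exponentialPDF a) (measurable_exponentialPDFReal a).ennreal_ofReal
    (Eventually.of_forall fun _ => by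
      simp [exponentialPDF]), ← integral_Ici_eq_integral_Ioi,
    ← integral_indicator measurableSet_Ici]
  congr 1
  ext u
  by_cases hu : 0 ≤ u
  · rw [Set.indicator_of_mem (by exact hu), exponentialPDF_of_nonneg hu,
      ENNReal.toReal_ofReal (by positivity), smul_eq_mul, neg_mul]
  · rw [Set.indicator_of_notMem (by exact hu), exponentialPDF_of_neg (not_le.mp hu)]
    simp

theorem integrable_expMeasure_iff {a : ℝ} (ha : 0 < a) (f : ℝ → ℝ) :
    Integrable f (expMeasure a) ↔
      IntegrableOn (fun u => Real.exp (-a * u) * f u) (Set.Ioi (0 : ℝ)) := by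
  have h1 : expMeasure a = volume.withDensity (exponentialPDF a) := rfl
  rw [h1, integrable_withDensity_iff_integrable_smul'
    (f := exponentialPDF a) (measurable_exponentialPDFReal a).ennreal_ofReal
    (Eventually.of_forall fun _ => by
      simp [exponentialPDF]), ← integrableOn_Ici_iff_integrableOn_Ioi,
    ← integrable_indicator_iff measurableSet_Ici]
  refine (integrable_congr (Eventually.of_forall fun u => ?_)).trans
    (integrable_const_mul_iff (c := a) (isUnit_iff_ne_zero.2 ha.ne') _)
  by_cases hu : 0 ≤ u
  · rw [Set.indicator_of_mem (by exact hu), exponentialPDF_of_nonneg hu,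
      ENNReal.toReal_ofReal (by positivity), smul_eq_mul, neg_mul, mul_assoc]
  · rw [Set.indicator_of_notMem (by exact hu), exponentialPDF_of_neg (not_le.mp hu)]
    simp

/-! ### Tame functions and their exponential averages. -/

/-- Continuous functions of subexponential growth in the mean. -/
structure Tame (y : ℝ → ℝ) : Prop where
  continuous : Continuous y
  integrable : ∀ ε : ℝ, 0 < ε → Integrable fun s => Real.exp (-ε * |s|) * y s

/-- The exponential moving average of rate `a`. -/
noncomputable def expAvg (a : ℝ) (y : ℝ → ℝ) (t : ℝ) : ℝ := ∫ u, y (t - u) ∂expMeasure a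

/-- The operator `T_a` after integration by parts. -/
noncomputable def ouTransform (a : ℝ) (y : ℝ → ℝ) (t : ℝ) : ℝ := y t - expAvg a y t

namespace Tame

variable {y z : ℝ → ℝ} {a b : ℝ}

theorem comp_neg (hy : Tame y) : Tame fun s => y (-s) :=
  ⟨hy.continuous.comp continuous_neg, fun ε hε => by simpa using (hy.integrable ε hε).comp_neg⟩

theorem add (hy : Tame y) (hz : Tame z) : Tame fun s => y s + z s :=
  ⟨hy.continuous.add hz.continuous, fun ε hε => by
    simp only [mul_add]
    exact (hy.integrable ε hε).add (hz.integrable ε hε)⟩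

theorem const_mul (hy : Tame y) (c : ℝ) : Tame fun s => c * y s :=
  ⟨hy.continuous.const_mul c, fun ε hε => by
    simpa [mul_left_comm] using (hy.integrable ε hε).const_mul c⟩

theorem sub (hy : Tame y) (hz : Tame z) : Tame fun s => y s - z s := by
  simpa [sub_eq_add_neg] using hy.add (hz.const_mul (-1))

theorem integrable_sub (hy : Tame y) (ha : 0 < a) (t : ℝ) :
    Integrable (fun u => y (t - u)) (expMeasure a) := by
  rw [integrable_expMeasure_iff ha]
  have h1 : Integrable fun u => Real.exp (a * |t|) * (Real.exp (-a * |t - u|) * y (t - u)) :=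
    ((hy.integrable a ha).comp_sub_left t).const_mul _
  refine Integrable.mono h1.integrableOn ?_ ?_
  · exact Continuous.aestronglyMeasurable (by have := hy.continuous; fun_prop)
  · refine (ae_restrict_iff' measurableSet_Ioi).2 (Eventually.of_forall fun u hu => ?_)
    rw [norm_mul, norm_mul, norm_mul, ← mul_assoc]
    refine mul_le_mul_of_nonneg_right ?_ (norm_nonneg _)
    simp only [Real.norm_eq_abs, Real.abs_exp]
    rw [← Real.exp_add]
    apply Real.exp_le_exp.2
    have h2 : |t - u| ≤ |t| + |u| := abs_sub _ _
    rw [abs_of_pos (show (0 : ℝ) < u from hu)] at h2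
    nlinarith

theorem integrable_add (hy : Tame y) (ha : 0 < a) (t : ℝ) :
    Integrable (fun u => y (t + u)) (expMeasure a) := by
  have := hy.comp_neg.integrable_sub ha (-t)
  simpa [add_comm] using this

end Tame

/-- Integration by parts against the exponential law. -/
theorem integral_deriv_expMeasure {a : ℝ} (ha : 0 < a) {g g' : ℝ → ℝ}
    (hg : ∀ u, HasDerivAt g (g' u) u) (hi : Integrable g (expMeasure a))
    (hi' : Integrable g' (expMeasure a)) :
    ∫ u, g' u ∂expMeasure a = a * (∫ u, g u ∂expMeasure a - g 0) := by
  rw [integral_expMeasure ha, integral_expMeasure ha]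
  rw [integrable_expMeasure_iff ha] at hi hi'
  have hd : ∀ u, HasDerivAt (fun u => Real.exp (-a * u) * g u)
      (Real.exp (-a * u) * g' u - a * (Real.exp (-a * u) * g u)) u := by
    intro u
    have h1 : HasDerivAt (fun u => Real.exp (-a * u)) (Real.exp (-a * u) * -a) u := by
      simpa using ((hasDerivAt_id u).const_mul (-a)).exp
    convert! h1.mul (hg u) using 1
    ring
  have hint : IntegrableOn (fun u => Real.exp (-a * u) * g' u - a * (Real.exp (-a * u) * g u))
      (Set.Ioi (0 : ℝ)) := hi'.sub (hi.const_mul a)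
  have hlim := tendsto_zero_of_hasDerivAt_of_integrableOn_Ioi (fun u _ => hd u) hint hi
  have h := integral_Ioi_of_hasDerivAt_of_tendsto' (fun u _ => hd u) hint hlim
  rw [integral_sub hi' (hi.const_mul a), integral_const_mul] at h
  simp only [mul_assoc, integral_const_mul]
  simp only [mul_zero, Real.exp_zero, one_mul, zero_sub] at h
  linear_combination a * h

/-- Substituting `s = t - u` moves `t` out of the argument of `y`, so that a merely continuous `y`
still gives an average differentiable in `t`. -/
theorem expAvg_eq_integral_Iic {a : ℝ} (ha : 0 < a) (y : ℝ → ℝ) (t : ℝ) :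
    expAvg a y t =
      a * Real.exp (-a * t) * ∫ s in Set.Iic t, Real.exp (a * s) * y s := by
  rw [expAvg, integral_expMeasure ha, ← integral_const_mul]
  have h := integral_comp_neg_Ioi (-t) (fun s => a * Real.exp (-a * t) * (Real.exp (a * s) * y s))
  rw [neg_neg] at h
  rw [← h]
  have h2 := (measurePreserving_sub_right volume t).setIntegral_preimage_emb
    (measurableEmbedding_subRight t)
    (fun s => a * Real.exp (-a * t) * (Real.exp (a * -s) * y (-s))) (Set.Ioi (-t))
  rw [← h2]
  have h3 : (fun x : ℝ => x - t) ⁻¹' Set.Ioi (-t) = Set.Ioi 0 := by ext x; simp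
  rw [h3]
  congr 1
  ext u
  rw [show a * -(u - t) = a * t + -a * u by ring, Real.exp_add, neg_sub]
  have : Real.exp (-a * t) * Real.exp (a * t) = 1 := by rw [← Real.exp_add]; simp
  linear_combination (-a * Real.exp (-a*u) * y (t-u)) * this

namespace Tame

variable {y z : ℝ → ℝ} {a b : ℝ}

theorem integrableOn_Iic (hy : Tame y) (ha : 0 < a) (t : ℝ) :
    IntegrableOn (fun s => Real.exp (a * s) * y s) (Set.Iic t) := by
  have h1 : Integrable fun s => Real.exp (2 * a * |t|) * (Real.exp (-a * |s|) * y s) :=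
    (hy.integrable a ha).const_mul _
  refine Integrable.mono h1.integrableOn ?_ ?_
  · exact Continuous.aestronglyMeasurable (by have := hy.continuous; fun_prop)
  · refine (ae_restrict_iff' measurableSet_Iic).2 (Eventually.of_forall fun s hs => ?_)
    rw [norm_mul, norm_mul, norm_mul, ← mul_assoc]
    refine mul_le_mul_of_nonneg_right ?_ (norm_nonneg _)
    simp only [Real.norm_eq_abs, Real.abs_exp]
    rw [← Real.exp_add]
    apply Real.exp_le_exp.2
    have hs' : s ≤ t := hs
    have h2 : s + |s| ≤ 2 * |t| := by
      rcases abs_cases s with h | h <;> rcases abs_cases t with h' | h' <;> linarith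
    nlinarith

theorem hasDerivAt_expAvg (hy : Tame y) (ha : 0 < a) (t : ℝ) :
    HasDerivAt (expAvg a y) (a * (y t - expAvg a y t)) t := by
  have hfun : expAvg a y = fun t => a * Real.exp (-a * t) *
      ((∫ s in Set.Iic 0, Real.exp (a * s) * y s) + ∫ s in (0 : ℝ)..t, Real.exp (a * s) * y s) := by
    ext t
    rw [expAvg_eq_integral_Iic ha, ← intervalIntegral.integral_Iic_sub_Iic
      (hy.integrableOn_Iic ha 0) (hy.integrableOn_Iic ha t)]
    ring
  have hc : Continuous fun s => Real.exp (a * s) * y s := by have := hy.continuous; fun_prop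
  have h1 : HasDerivAt (fun t => a * Real.exp (-a * t)) (a * (Real.exp (-a * t) * -a)) t := by
    simpa using (((hasDerivAt_id t).const_mul (-a)).exp).const_mul a
  have h2 := ((intervalIntegral.integral_hasDerivAt_right (hc.intervalIntegrable 0 t)
    (hc.stronglyMeasurableAtFilter _ _) hc.continuousAt).const_add
      (∫ s in Set.Iic 0, Real.exp (a * s) * y s))
  rw [hfun]
  convert! h1.mul h2 using 1
  have : Real.exp (-a * t) * Real.exp (a * t) = 1 := by rw [← Real.exp_add]; simp
  linear_combination (-a * y t) * this

theorem continuous_expAvg (hy : Tame y) (ha : 0 < a) : Continuous (expAvg a y) :=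
  continuous_iff_continuousAt.2 fun t => (hy.hasDerivAt_expAvg ha t).continuousAt

/-- For `u > 0`, `e^{-au} ≤ e^{-εu} ≤ e^{ε|t|} e^{-ε|t-u|}`. As `ε` may be arbitrarily small,
averages of tame functions are again tame. -/
theorem abs_expAvg_le (hy : Tame y) (ha : 0 < a) {ε : ℝ} (hε : 0 < ε) (hεa : ε ≤ a) (t : ℝ) :
    |expAvg a y t| ≤ (a * ∫ s, |Real.exp (-ε * |s|) * y s|) * Real.exp (ε * |t|) := by
  rw [expAvg, integral_expMeasure ha]
  have h1 : Integrable fun u =>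
      a * Real.exp (ε * |t|) * |Real.exp (-ε * |t - u|) * y (t - u)| :=
    (((hy.integrable ε hε).abs).comp_sub_left t).const_mul _
  calc |∫ u in Set.Ioi (0 : ℝ), a * Real.exp (-a * u) * y (t - u)|
      ≤ ∫ u in Set.Ioi (0 : ℝ), a * Real.exp (ε * |t|) *
          |Real.exp (-ε * |t - u|) * y (t - u)| := by
        rw [← Real.norm_eq_abs]
        refine norm_integral_le_of_norm_le h1.integrableOn ?_
        refine (ae_restrict_iff' measurableSet_Ioi).2 (Eventually.of_forall fun u hu => ?_)
        have hu' : (0 : ℝ) < u := hu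
        rw [norm_mul, norm_mul, abs_mul, ← mul_assoc, mul_assoc a]
        refine mul_le_mul_of_nonneg_right ?_ (norm_nonneg _)
        simp only [Real.norm_eq_abs, Real.abs_exp, abs_of_pos ha]
        rw [← Real.exp_add]
        refine mul_le_mul_of_nonneg_left (Real.exp_le_exp.2 ?_) ha.le
        have h2 : |t - u| ≤ |t| + |u| := abs_sub _ _
        rw [abs_of_pos hu'] at h2
        nlinarith
    _ ≤ ∫ u, a * Real.exp (ε * |t|) * |Real.exp (-ε * |t - u|) * y (t - u)| :=
        setIntegral_le_integral h1 (Eventually.of_forall fun u => by positivity)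
    _ = _ := by
        rw [integral_const_mul,
          integral_sub_left_eq_self (fun s => |Real.exp (-ε * |s|) * y s|) volume t]
        ring

theorem integrable_exp_neg_abs {c : ℝ} (hc : 0 < c) :
    Integrable fun s : ℝ => Real.exp (-c * |s|) := by
  rw [← integrableOn_univ, ← Set.Iic_union_Ioi (a := (0 : ℝ)), integrableOn_union]
  refine ⟨(integrableOn_exp_mul_Iic hc 0).congr_fun (fun s hs => ?_) measurableSet_Iic,
    (integrableOn_exp_mul_Ioi (neg_lt_zero.2 hc) 0).congr_fun (fun s hs => ?_) measurableSet_Ioi⟩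
  · simp only; rw [abs_of_nonpos hs]; ring_nf
  · simp only; rw [abs_of_pos hs]

theorem of_bound (hy : Continuous y)
    (h : ∀ ε : ℝ, 0 < ε → ∃ δ < ε, ∃ C : ℝ, ∀ s, |y s| ≤ C * Real.exp (δ * |s|)) : Tame y := by
  refine ⟨hy, fun ε hε => ?_⟩
  obtain ⟨δ, hδ, C, hC⟩ := h ε hε
  refine Integrable.mono' ((integrable_exp_neg_abs (sub_pos.2 hδ)).const_mul C)
    (Continuous.aestronglyMeasurable (by fun_prop)) (Eventually.of_forall fun s => ?_)
  rw [norm_mul, Real.norm_eq_abs, Real.abs_exp, Real.norm_eq_abs]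
  calc Real.exp (-ε * |s|) * |y s| ≤ Real.exp (-ε * |s|) * (C * Real.exp (δ * |s|)) := by
        gcongr; exact hC s
    _ = C * (Real.exp (-ε * |s|) * Real.exp (δ * |s|)) := by ring
    _ = _ := by rw [← Real.exp_add]; ring_nf

theorem expAvg (hy : Tame y) (ha : 0 < a) : Tame (expAvg a y) := by
  refine of_bound (hy.continuous_expAvg ha) fun ε hε => ?_
  have hpos : 0 < min (ε / 2) a := lt_min (by positivity) ha
  exact ⟨min (ε / 2) a, (min_le_left _ _).trans_lt (by linarith), _,
    hy.abs_expAvg_le ha hpos (min_le_right _ _)⟩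

theorem ouTransform (hy : Tame y) (ha : 0 < a) : Tame (ouTransform a y) :=
  hy.sub (hy.expAvg ha)

/-- Resolvent identity: average the equation `z' = b (y - z)` for `z = A_b y` along `u ↦ t - u` with
rate `a`, and integrate by parts. -/
theorem expAvg_expAvg (hy : Tame y) (ha : 0 < a) (hb : 0 < b) (t : ℝ) :
    (a - b) * _root_.expAvg a (_root_.expAvg b y) t =
      a * _root_.expAvg b y t - b * _root_.expAvg a y t := by
  have hz := hy.expAvg hb
  have h := integral_deriv_expMeasure ha
    (g := fun u => _root_.expAvg b y (t - u))
    (g' := fun u => -(b * (y (t - u) - _root_.expAvg b y (t - u))))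
    (fun u => by simpa using (hy.hasDerivAt_expAvg hb (t - u)).comp_const_sub t u)
    (hz.integrable_sub ha t)
    ((((hy.integrable_sub ha t).sub (hz.integrable_sub ha t)).const_mul b).neg)
  rw [integral_neg, integral_const_mul, integral_sub (hy.integrable_sub ha t)
    (hz.integrable_sub ha t), sub_zero] at h
  change -(b * (_root_.expAvg a y t - _root_.expAvg a (_root_.expAvg b y) t)) =
    a * (_root_.expAvg a (_root_.expAvg b y) t - _root_.expAvg b y t) at h
  linear_combination -h

/-- The same argument along `u ↦ t + u`; the reversed direction changes `a - b` into `a + b`. It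
eliminates the double average in the cross-covariances. -/
theorem integral_expAvg_add (hy : Tame y) (ha : 0 < a) (hb : 0 < b) (t : ℝ) :
    (a + b) * ∫ u, _root_.expAvg b y (t + u) ∂expMeasure a =
      a * _root_.expAvg b y t + b * ∫ u, y (t + u) ∂expMeasure a := by
  have hz := hy.expAvg hb
  have h := integral_deriv_expMeasure ha
    (g := fun u => _root_.expAvg b y (t + u))
    (g' := fun u => b * (y (t + u) - _root_.expAvg b y (t + u)))
    (fun u => (hy.hasDerivAt_expAvg hb (t + u)).comp_const_add t u)
    (hz.integrable_add ha t)
    (((hy.integrable_add ha t).sub (hz.integrable_add ha t)).const_mul b)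
  rw [integral_const_mul, integral_sub (hy.integrable_add ha t)
    (hz.integrable_add ha t), add_zero] at h
  linear_combination -h

end Tame

/-! ### Riemann–Stieltjes integrals and the transform `1 - A_a`. -/

/-- Integration by parts determines the value of a Riemann–Stieltjes integral. -/
theorem HasRSIntegral.eq_of_hasDerivAt {f f' y : ℝ → ℝ} {a b I : ℝ} (hab : a ≤ b)
    (hI : HasRSIntegral f y a b I) (hf : ∀ x, HasDerivAt f (f' x) x) (hf' : Continuous f')
    (hy : Continuous y) :
    I = f b * y b - f a * y a - ∫ s in a..b, y s * f' s := by
  obtain ⟨M, hM⟩ := (isCompact_Icc (a := a) (b := b)).exists_bound_of_continuousOn hf'.continuousOn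
  have hM0 : 0 ≤ M := (norm_nonneg _).trans (hM a ⟨le_rfl, hab⟩)
  have hba : 0 ≤ b - a := sub_nonneg.2 hab
  have hyf : Continuous fun s => y s * f' s := hy.mul hf'
  set J := f b * y b - f a * y a - ∫ s in a..b, y s * f' s with hJ
  have key : ∀ ε > 0, |I - J| ≤ ε * (1 + M * (b - a)) := by
    intro ε hε
    obtain ⟨δ, hδ, h1⟩ := hI ε hε
    obtain ⟨δ', hδ', h2⟩ := Metric.uniformContinuousOn_iff.1
      ((isCompact_Icc (a := a) (b := b)).uniformContinuousOn_of_continuous hy.continuousOn) ε hε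
    obtain ⟨n, hn⟩ := exists_nat_gt ((b - a) / min δ δ')
    have hm : 0 < min δ δ' := lt_min hδ hδ'
    have hn0 : (0 : ℝ) < n := lt_of_le_of_lt (by positivity) hn
    have hstep : (b - a) / n < min δ δ' := by
      rw [div_lt_iff₀ hn0]; rw [div_lt_iff₀ hm] at hn; linarith
    set d := (b - a) / n with hd
    have hd0 : 0 ≤ d := by positivity
    set u : ℕ → ℝ := fun i => a + i * d with hu
    have hu0 : u 0 = a := by simp [hu]
    have hun : u n = b := by simp only [hu, hd]; field_simp; ring
    have hsucc : ∀ i, u (i + 1) = u i + d := by intro i; simp only [hu]; push_cast; ring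
    have hle : ∀ i, u i ≤ u (i + 1) := fun i => by rw [hsucc]; linarith
    have hmono : Monotone u := monotone_nat_of_le_succ hle
    have hmem : ∀ i < n, Set.Icc (u i) (u (i + 1)) ⊆ Set.Icc a b := fun i hi =>
      Set.Icc_subset_Icc (hu0 ▸ hmono (Nat.zero_le i)) (hun ▸ hmono hi)
    -- Tags at right endpoints make Abel summation leave `y` at left endpoints, without a correction
    -- term.
    have h3 := h1 n u (fun i => u (i + 1)) hu0 hun fun i _ =>
      ⟨hle i, le_rfl, by rw [hsucc]; linarith [min_le_left δ δ']⟩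
    have hparts : ∑ i ∈ Finset.range n, f (u (i + 1)) * (y (u (i + 1)) - y (u i)) =
        f b * y b - f a * y a - ∑ i ∈ Finset.range n, y (u i) * (f (u (i + 1)) - f (u i)) := by
      rw [eq_sub_iff_add_eq, ← Finset.sum_add_distrib]
      have := Finset.sum_range_sub (fun i => f (u i) * y (u i)) n
      simp only [hu0, hun] at this
      rw [← this]
      exact Finset.sum_congr rfl fun i _ => by ring
    have hsum : ∑ i ∈ Finset.range n, y (u i) * (f (u (i + 1)) - f (u i)) -
        ∫ s in a..b, y s * f' s =
        ∑ i ∈ Finset.range n, ∫ s in u i..u (i + 1), (y (u i) - y s) * f' s := by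
      rw [← hu0, ← hun, ← intervalIntegral.sum_integral_adjacent_intervals (a := u)
        (fun k _ => hyf.intervalIntegrable _ _), ← Finset.sum_sub_distrib]
      refine Finset.sum_congr rfl fun i _ => ?_
      rw [← intervalIntegral.integral_eq_sub_of_hasDerivAt (fun x _ => hf x)
        (hf'.intervalIntegrable _ _), ← intervalIntegral.integral_const_mul,
        ← intervalIntegral.integral_sub ((hf'.const_mul _).intervalIntegrable _ _)
          (hyf.intervalIntegrable _ _)]
      exact intervalIntegral.integral_congr fun s _ => by ring
    have hbound : |∑ i ∈ Finset.range n, ∫ s in u i..u (i + 1), (y (u i) - y s) * f' s| ≤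
        ε * (M * (b - a)) := by
      calc _ ≤ ∑ i ∈ Finset.range n, |∫ s in u i..u (i + 1), (y (u i) - y s) * f' s| :=
            Finset.abs_sum_le_sum_abs _ _
        _ ≤ ∑ i ∈ Finset.range n, ε * M * d := by
            refine Finset.sum_le_sum fun i hi => ?_
            have hin := Finset.mem_range.1 hi
            have := intervalIntegral.norm_integral_le_of_norm_le_const (a := u i) (b := u (i + 1))
              (f := fun s => (y (u i) - y s) * f' s) (C := ε * M) fun s hs => ?_
            · rwa [hsucc, add_sub_cancel_left, abs_of_nonneg hd0, ← hsucc] at this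
            · rw [Set.uIoc_of_le (hle i)] at hs
              have hs' : s ∈ Set.Icc (u i) (u (i + 1)) := ⟨hs.1.le, hs.2⟩
              rw [norm_mul]
              refine mul_le_mul ?_ (hM s (hmem i hin hs')) (norm_nonneg _) hε.le
              rw [← dist_eq_norm]
              refine (h2 (u i) (hmem i hin ⟨le_rfl, hle i⟩) s (hmem i hin hs') ?_).le
              rw [dist_comm, Real.dist_eq, abs_of_nonneg (by linarith [hs'.1])]
              have := hs'.2
              rw [hsucc] at this
              linarith [min_le_right δ δ']
        _ = ε * (M * (b - a)) := by
            rw [Finset.sum_const, Finset.card_range, nsmul_eq_mul, hd]; field_simp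
    rw [hparts] at h3
    rw [← hsum] at hbound
    have h4 : I - J = -(∑ i ∈ Finset.range n, y (u i) * (f (u (i + 1)) - f (u i)) -
        ∫ s in a..b, y s * f' s) - (f b * y b - f a * y a -
          ∑ i ∈ Finset.range n, y (u i) * (f (u (i + 1)) - f (u i)) - I) := by
      rw [hJ]; ring
    rw [h4]
    refine (abs_sub _ _).trans ?_
    rw [abs_neg]
    linarith
  have hpos : 0 < 1 + M * (b - a) := by positivity
  have h0 : |I - J| ≤ 0 := le_of_forall_pos_le_add fun η hη => by
    have := key (η / (1 + M * (b - a))) (by positivity)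
    rw [div_mul_cancel₀ _ hpos.ne'] at this
    linarith
  exact sub_eq_zero.1 (abs_nonpos_iff.1 h0)

/-- Integration by parts on `[a, t]` leaves the boundary term `e^{-r(t-a)} y(a)`. Convergence of the
improper integral forces it to have a limit as `a → -∞`, and integrability of `e^{rs} y(s)` forces
that limit to be zero; no pointwise growth bound on `y` is required. -/
theorem HasOUIntegral.eq_ouTransform {r : ℝ} (hr : 0 < r) {y : ℝ → ℝ} (hy : Tame y) {t I : ℝ}
    (hI : HasOUIntegral r y t I) : I = ouTransform r y t := by
  obtain ⟨F, hF, hlim⟩ := hI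
  set g : ℝ → ℝ := fun s => Real.exp (r * s) * y s with hg
  have hgi : IntegrableOn g (Set.Iic t) := hy.integrableOn_Iic hr t
  have hFa : ∀ a ≤ t, Real.exp (-r * t) * g a =
      y t - r * Real.exp (-r * t) * (∫ s in a..t, g s) - F a := by
    intro a hat
    have h1 := (hF a hat).eq_of_hasDerivAt (f' := fun s => r * Real.exp (-r * (t - s))) hat
      (fun x => by
        simpa [mul_comm] using ((((hasDerivAt_id x).const_sub t).const_mul (-r)).exp))
      (by fun_prop) hy.continuous
    have hexp : ∀ s, Real.exp (-r * (t - s)) = Real.exp (-r * t) * Real.exp (r * s) := fun s => by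
      rw [← Real.exp_add]; ring_nf
    have h2 : ∫ s in a..t, y s * (r * Real.exp (-r * (t - s))) =
        r * Real.exp (-r * t) * ∫ s in a..t, g s := by
      rw [← intervalIntegral.integral_const_mul]
      exact intervalIntegral.integral_congr fun s _ => by simp only [hg, hexp]; ring
    rw [h1, h2]
    simp only [hexp a, hg]
    simp
    ring
  have hint : Tendsto (fun a => ∫ s in a..t, g s) atBot (𝓝 (∫ s in Set.Iic t, g s)) :=
    intervalIntegral_tendsto_integral_Iic t hgi tendsto_id
  have h3 : Tendsto g atBot (𝓝 (Real.exp (r * t) *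
      (y t - r * Real.exp (-r * t) * (∫ s in Set.Iic t, g s) - I))) := by
    refine (((tendsto_const_nhds.sub (hint.const_mul _)).sub hlim).const_mul _).congr' ?_
    filter_upwards [eventually_le_atBot t] with a ha
    rw [← hFa a ha, ← mul_assoc, ← Real.exp_add]
    simp
  -- An integrable function can only tend to zero along `atBot`, all of whose sets have infinite
  -- Lebesgue measure.
  have h4 := IntegrableAtFilter.eq_zero_of_tendsto (f := g) (μ := volume) (l := atBot)
    ⟨Set.Iic t, Iic_mem_atBot t, hgi⟩ (fun s hs => ?_) h3
  · have h5 := (mul_eq_zero.1 h4).resolve_left (Real.exp_pos _).ne'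
    rw [ouTransform, expAvg_eq_integral_Iic hr]
    linarith
  · obtain ⟨c, hc⟩ := mem_atBot_sets.1 hs
    exact measure_mono_top (fun x hx => hc x hx) (Real.volume_Iic (a := c))

theorem tame_foldr_ouTransform {rs : List ℝ} (hrs : ∀ r ∈ rs, 0 < r) {y : ℝ → ℝ} (hy : Tame y) :
    Tame (rs.foldr ouTransform y) := by
  induction rs with
  | nil => exact hy
  | cons r rs ih =>
    exact (ih fun q hq => hrs q (List.mem_cons_of_mem _ hq)).ouTransform (hrs r List.mem_cons_self)

theorem IsIteratedOU.eq_foldr {rs : List ℝ} (hrs : ∀ r ∈ rs, 0 < r) {y : ℝ → ℝ} (hy : Tame y)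
    {x : ℝ → ℝ} (hx : IsIteratedOU rs y x) : x = rs.foldr ouTransform y := by
  induction rs generalizing x with
  | nil => exact hx
  | cons r rs ih =>
    obtain ⟨z, hz, hxt⟩ := hx
    have hrs' : ∀ q ∈ rs, 0 < q := fun q hq => hrs q (List.mem_cons_of_mem _ hq)
    rw [ih hrs' hz] at hxt
    exact funext fun t =>
      (hxt t).eq_ouTransform (hrs r List.mem_cons_self) (tame_foldr_ouTransform hrs' hy)

/-! ### Second moments and second-order processes. -/

theorem memLp_two_of_lintegral_sq_ne_top {α : Type*} [MeasurableSpace α] {μ : Measure α} {f : α → ℝ}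
    (hf : AEStronglyMeasurable f μ) (h : ∫⁻ x, ‖f x‖ₑ ^ 2 ∂μ ≠ ⊤) : MemLp f 2 μ := by
  rw [memLp_two_iff_integrable_sq hf]
  refine ⟨hf.pow 2, ?_⟩
  rw [HasFiniteIntegral]
  simpa only [enorm_pow] using h.lt_top

theorem enorm_integral_sq_le {α : Type*} [MeasurableSpace α] {μ : Measure α}
    [IsProbabilityMeasure μ] {f : α → ℝ} (hf : AEStronglyMeasurable f μ) :
    ‖∫ x, f x ∂μ‖ₑ ^ 2 ≤ ∫⁻ x, ‖f x‖ₑ ^ 2 ∂μ := by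
  have h1 : ‖∫ x, f x ∂μ‖ₑ ≤ eLpNorm f 2 μ := by
    refine (enorm_integral_le_lintegral_enorm f).trans ?_
    rw [← eLpNorm_one_eq_lintegral_enorm]
    exact eLpNorm_le_eLpNorm_of_exponent_le (by norm_num) hf
  have h2 := eLpNorm_nnreal_pow_eq_lintegral (f := f) (μ := μ) (p := 2) two_ne_zero
  simp only [NNReal.coe_ofNat, ENNReal.rpow_ofNat, ENNReal.coe_ofNat] at h2
  rw [← h2]
  gcongr

theorem integral_sq_le_of_lintegral_le {α : Type*} [MeasurableSpace α] {μ : Measure α} {f : α → ℝ}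
    (hf : AEStronglyMeasurable f μ) {c : ℝ} (hc : 0 ≤ c)
    (h : ∫⁻ x, ‖f x‖ₑ ^ 2 ∂μ ≤ ENNReal.ofReal c) : ∫ x, f x ^ 2 ∂μ ≤ c := by
  rw [integral_eq_lintegral_of_nonneg_ae (Eventually.of_forall fun x => sq_nonneg _) (hf.pow 2)]
  refine ENNReal.toReal_le_of_le_ofReal hc (le_trans (le_of_eq ?_) h)
  congr 1
  ext x
  rw [← enorm_pow, Real.enorm_eq_ofReal (sq_nonneg _)]

theorem integral_sq_expMeasure {a : ℝ} (ha : 0 < a) :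
    Integrable (fun u => u ^ 2) (expMeasure a) ∧ ∫ u, u ^ 2 ∂expMeasure a = 2 / a ^ 2 := by
  have h : ∫ u, u ^ 2 ∂expMeasure a = 2 / a ^ 2 := by
    have h1 := Real.integral_rpow_mul_exp_neg_mul_Ioi (a := 3) (r := a) (by norm_num) ha
    have h2 : Real.Gamma 3 = 2 := by
      have := Real.Gamma_nat_eq_factorial 2
      norm_num at this ⊢
    rw [h2, Real.rpow_ofNat] at h1
    rw [integral_expMeasure ha]
    simp only [mul_assoc]
    rw [integral_const_mul]
    have h3 : ∫ u in Set.Ioi (0 : ℝ), Real.exp (-a * u) * u ^ 2 = (1 / a) ^ 3 * 2 := by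
      rw [← h1]
      refine integral_congr_ae (Eventually.of_forall fun u => ?_)
      simp only
      rw [show (3 : ℝ) - 1 = 2 by norm_num, Real.rpow_ofNat, neg_mul, mul_comm]
    rw [h3]
    field_simp
  -- The Bochner integral of a non-integrable function is `0`, so the nonzero value proves
  -- integrability.
  exact ⟨.of_integral_ne_zero (by rw [h]; positivity), h⟩

theorem lintegral_one_add_sq_expMeasure {a : ℝ} (ha : 0 < a) :
    ∫⁻ u, ENNReal.ofReal (1 + u ^ 2) ∂expMeasure a = ENNReal.ofReal (1 + 2 / a ^ 2) := by
  have := isProbabilityMeasure_expMeasure ha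
  obtain ⟨h1, h2⟩ := integral_sq_expMeasure ha
  rw [← ofReal_integral_eq_lintegral_ofReal (f := fun u => 1 + u ^ 2) ((integrable_const 1).add h1)
    (Eventually.of_forall fun u => by positivity), integral_add (integrable_const 1) h1, h2]
  simp

section Stochastic

variable {Ω : Type*} [MeasurableSpace Ω] {P : Measure Ω}

/-- Jointly measurable centred processes whose second moments grow at most quadratically. -/
structure IsSecondOrder (P : Measure Ω) (Y : ℝ → Ω → ℝ) : Prop where
  measurable : Measurable (Function.uncurry Y)
  growth : ∃ C : ℝ, 0 ≤ C ∧ ∀ t, ∫⁻ ω, ‖Y t ω‖ₑ ^ 2 ∂P ≤ ENNReal.ofReal (C * (1 + t ^ 2))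
  centred : ∀ t, ∫ ω, Y t ω ∂P = 0

/-- The bound comes from `1 + (t - u)² ≤ 2 (1 + t²)(1 + u²)`. The constant is explicit because
uniformity in the rate is needed later. -/
theorem lintegral_shift_le {Y : ℝ → Ω → ℝ} {a : ℝ} {C : ℝ} (hC0 : 0 ≤ C)
    (hC : ∀ t, ∫⁻ ω, ‖Y t ω‖ₑ ^ 2 ∂P ≤ ENNReal.ofReal (C * (1 + t ^ 2))) (ha : 0 < a) (t : ℝ) :
    ∫⁻ u, ∫⁻ ω, ‖Y (t - u) ω‖ₑ ^ 2 ∂P ∂expMeasure a ≤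
      ENNReal.ofReal (2 * C * (1 + 2 / a ^ 2) * (1 + t ^ 2)) := by
  calc _ ≤ ∫⁻ u, ENNReal.ofReal (2 * C * (1 + t ^ 2)) * ENNReal.ofReal (1 + u ^ 2)
        ∂expMeasure a := by
        refine lintegral_mono fun u => (hC (t - u)).trans ?_
        rw [← ENNReal.ofReal_mul (by positivity)]
        refine ENNReal.ofReal_le_ofReal ?_
        rw [mul_comm 2 C, mul_assoc, mul_assoc]
        refine mul_le_mul_of_nonneg_left ?_ hC0
        nlinarith [sq_nonneg (t + u), sq_nonneg (t * u)]
    _ = _ := by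
        rw [lintegral_const_mul _ (by fun_prop), lintegral_one_add_sq_expMeasure ha,
          ← ENNReal.ofReal_mul (by positivity)]
        ring_nf

namespace IsSecondOrder

variable {Y : ℝ → Ω → ℝ} {a : ℝ}

theorem measurable_apply (hY : IsSecondOrder P Y) (t : ℝ) : Measurable (Y t) :=
  hY.measurable.comp measurable_prodMk_left

theorem memLp (hY : IsSecondOrder P Y) (t : ℝ) : MemLp (Y t) 2 P := by
  obtain ⟨C, -, hC⟩ := hY.growth
  exact memLp_two_of_lintegral_sq_ne_top (hY.measurable_apply t).aestronglyMeasurable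
    ((hC t).trans_lt ENNReal.ofReal_lt_top).ne

theorem measurable_shift (hY : IsSecondOrder P Y) (t : ℝ) :
    Measurable (Function.uncurry fun u => Y (t - u)) :=
  hY.measurable.comp ((measurable_const.sub measurable_fst).prodMk measurable_snd)

theorem measurable_expAvg (hY : IsSecondOrder P Y) (ha : 0 < a) :
    Measurable (Function.uncurry fun t ω => expAvg a (fun s => Y s ω) t) := by
  have := isProbabilityMeasure_expMeasure ha
  have h : Measurable fun q : (ℝ × Ω) × ℝ => Y (q.1.1 - q.2) q.1.2 :=
    hY.measurable.comp (((measurable_fst.comp measurable_fst).sub measurable_snd).prodMk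
      (measurable_snd.comp measurable_fst))
  exact h.stronglyMeasurable.integral_prod_right'.measurable

end IsSecondOrder

variable [IsProbabilityMeasure P]

theorem memLp_prod_of_lintegral {μ : Measure ℝ} [SFinite μ] {U : ℝ → Ω → ℝ}
    (hU : Measurable (Function.uncurry U)) (h : ∫⁻ u, ∫⁻ ω, ‖U u ω‖ₑ ^ 2 ∂P ∂μ ≠ ⊤) :
    MemLp (fun p : Ω × ℝ => U p.2 p.1) 2 (P.prod μ) := by
  have hm : Measurable fun p : Ω × ℝ => U p.2 p.1 := hU.comp measurable_swap
  refine memLp_two_of_lintegral_sq_ne_top hm.aestronglyMeasurable ?_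
  rwa [lintegral_prod_symm _ (hm.enorm.pow_const 2).aemeasurable]

/-- The product of two averages of second-order families. -/
theorem integral_mul_integral {μ ν : Measure ℝ} [IsProbabilityMeasure μ] [IsProbabilityMeasure ν]
    {U V : ℝ → Ω → ℝ} (hU : MemLp (fun p : Ω × ℝ => U p.2 p.1) 2 (P.prod μ))
    (hV : MemLp (fun p : Ω × ℝ => V p.2 p.1) 2 (P.prod ν)) :
    ∫ ω, (∫ u, U u ω ∂μ) * (∫ v, V v ω ∂ν) ∂P = ∫ u, ∫ v, ∫ ω, U u ω * V v ω ∂P ∂ν ∂μ := by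
  have h1 : MeasurePreserving (Prod.map id Prod.fst : Ω × ℝ × ℝ → Ω × ℝ)
      (P.prod (μ.prod ν)) (P.prod μ) :=
    (MeasurePreserving.id P).prod measurePreserving_fst
  have h2 : MeasurePreserving (Prod.map id Prod.snd : Ω × ℝ × ℝ → Ω × ℝ)
      (P.prod (μ.prod ν)) (P.prod ν) :=
    (MeasurePreserving.id P).prod measurePreserving_snd
  have hint : Integrable (Function.uncurry fun (ω : Ω) (q : ℝ × ℝ) => U q.1 ω * V q.2 ω)
      (P.prod (μ.prod ν)) :=
    -- Both factors are square integrable on `Ω × ℝ × ℝ`, so their product is integrable and Fubini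
    -- applies.
    (hU.comp_measurePreserving h1).integrable_mul (hV.comp_measurePreserving h2)
  calc _ = ∫ ω, ∫ q : ℝ × ℝ, U q.1 ω * V q.2 ω ∂(μ.prod ν) ∂P := by
        refine integral_congr_ae (Eventually.of_forall fun ω => ?_)
        exact (integral_prod_mul (fun u => U u ω) (fun v => V v ω)).symm
    _ = ∫ q : ℝ × ℝ, ∫ ω, U q.1 ω * V q.2 ω ∂P ∂(μ.prod ν) := integral_integral_swap hint
    _ = _ := integral_prod _ hint.integral_prod_right

namespace IsSecondOrder

variable {Y Z : ℝ → Ω → ℝ} {a : ℝ}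

theorem memLp_shift (hY : IsSecondOrder P Y) (ha : 0 < a) (t : ℝ) :
    MemLp (fun p : Ω × ℝ => Y (t - p.2) p.1) 2 (P.prod (expMeasure a)) := by
  have := isProbabilityMeasure_expMeasure ha
  obtain ⟨C, hC0, hC⟩ := hY.growth
  exact memLp_prod_of_lintegral (U := fun u => Y (t - u)) (hY.measurable_shift t)
    ((lintegral_shift_le hC0 hC ha t).trans_lt ENNReal.ofReal_lt_top).ne

/-- Jensen's inequality for the exponential law, then Tonelli. -/
theorem lintegral_expAvg_le (hY : IsSecondOrder P Y) {C : ℝ} (hC0 : 0 ≤ C)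
    (hC : ∀ t, ∫⁻ ω, ‖Y t ω‖ₑ ^ 2 ∂P ≤ ENNReal.ofReal (C * (1 + t ^ 2))) (ha : 0 < a) (t : ℝ) :
    ∫⁻ ω, ‖expAvg a (fun s => Y s ω) t‖ₑ ^ 2 ∂P ≤
      ENNReal.ofReal (2 * C * (1 + 2 / a ^ 2) * (1 + t ^ 2)) := by
  have := isProbabilityMeasure_expMeasure ha
  refine le_trans ?_ (lintegral_shift_le hC0 hC ha t)
  rw [lintegral_lintegral_swap ((hY.measurable_shift t).enorm.pow_const 2).aemeasurable]
  refine lintegral_mono fun ω => enorm_integral_sq_le ?_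
  exact ((hY.measurable_shift t).comp measurable_prodMk_right).aestronglyMeasurable

theorem expAvg (hY : IsSecondOrder P Y) (ha : 0 < a) :
    IsSecondOrder P fun t ω => expAvg a (fun s => Y s ω) t := by
  have := isProbabilityMeasure_expMeasure ha
  obtain ⟨C, hC0, hC⟩ := hY.growth
  refine ⟨hY.measurable_expAvg ha, ⟨2 * C * (1 + 2 / a ^ 2), by positivity,
    fun t => hY.lintegral_expAvg_le hC0 hC ha t⟩, fun t => ?_⟩
  have h := integral_integral_swap (f := fun (ω : Ω) (u : ℝ) => Y (t - u) ω)
    ((hY.memLp_shift ha t).integrable one_le_two)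
  simp only [hY.centred, integral_zero] at h
  exact h

theorem sub (hY : IsSecondOrder P Y) (hZ : IsSecondOrder P Z) :
    IsSecondOrder P fun t ω => Y t ω - Z t ω := by
  obtain ⟨C, hC0, hC⟩ := hY.growth
  obtain ⟨D, hD0, hD⟩ := hZ.growth
  refine ⟨hY.measurable.sub hZ.measurable, ⟨2 * (C + D), by positivity, fun t => ?_⟩, fun t => ?_⟩
  · have h2 : ∀ x y : ℝ, ‖x - y‖ₑ ^ 2 ≤ 2 * ‖x‖ₑ ^ 2 + 2 * ‖y‖ₑ ^ 2 := by
      intro x y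
      rw [← enorm_pow, ← enorm_pow, ← enorm_pow, Real.enorm_eq_ofReal (sq_nonneg _),
        Real.enorm_eq_ofReal (sq_nonneg _), Real.enorm_eq_ofReal (sq_nonneg _),
        show (2 : ENNReal) = ENNReal.ofReal 2 by simp, ← ENNReal.ofReal_mul (by norm_num),
        ← ENNReal.ofReal_mul (by norm_num), ← ENNReal.ofReal_add (by positivity) (by positivity)]
      exact ENNReal.ofReal_le_ofReal (by nlinarith [sq_nonneg (x + y)])
    calc _ ≤ ∫⁻ ω, (2 * ‖Y t ω‖ₑ ^ 2 + 2 * ‖Z t ω‖ₑ ^ 2) ∂P := lintegral_mono fun ω => h2 _ _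
      _ = 2 * ∫⁻ ω, ‖Y t ω‖ₑ ^ 2 ∂P + 2 * ∫⁻ ω, ‖Z t ω‖ₑ ^ 2 ∂P := by
        have := hY.measurable_apply t
        have := hZ.measurable_apply t
        rw [lintegral_add_left (by fun_prop), lintegral_const_mul _ (by fun_prop),
          lintegral_const_mul _ (by fun_prop)]
      _ ≤ 2 * ENNReal.ofReal (C * (1 + t ^ 2)) + 2 * ENNReal.ofReal (D * (1 + t ^ 2)) := by
        gcongr
        · exact hC t
        · exact hD t
      _ = _ := by
        rw [show (2 : ENNReal) = ENNReal.ofReal 2 by simp, ← ENNReal.ofReal_mul (by norm_num),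
          ← ENNReal.ofReal_mul (by norm_num), ← ENNReal.ofReal_add (by positivity) (by positivity)]
        ring_nf
  · rw [integral_sub ((hY.memLp t).integrable one_le_two) ((hZ.memLp t).integrable one_le_two),
      hY.centred, hZ.centred, sub_zero]

theorem ouTransform (hY : IsSecondOrder P Y) (ha : 0 < a) :
    IsSecondOrder P fun t ω => ouTransform a (fun s => Y s ω) t :=
  hY.sub (hY.expAvg ha)

end IsSecondOrder

end Stochastic

/-! ### Versions of fractional Brownian motion with tame paths. -/

theorem sq_le_exp {δ : ℝ} (hδ : 0 < δ) {x : ℝ} (hx : 0 ≤ x) :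
    x ^ 2 ≤ 2 / δ ^ 2 * Real.exp (δ * x) := by
  have h := Real.pow_div_factorial_le_exp (δ * x) (by positivity) 2
  rw [mul_pow] at h
  rw [div_mul_eq_mul_div, le_div_iff₀ (by positivity)]
  norm_num at h
  linarith

theorem Tame.of_abs_le_sq {y : ℝ → ℝ} (hy : Continuous y) {C : ℝ} (hC : 0 ≤ C)
    (h : ∀ s, |y s| ≤ C * (1 + s ^ 2)) : Tame y := by
  refine Tame.of_bound hy fun ε hε => ⟨ε / 2, by linarith, C * (1 + 2 / (ε / 2) ^ 2), fun s => ?_⟩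
  refine (h s).trans ?_
  rw [mul_assoc]
  refine mul_le_mul_of_nonneg_left ?_ hC
  have h1 := sq_le_exp (half_pos hε) (abs_nonneg s)
  rw [sq_abs] at h1
  have h2 : 1 ≤ Real.exp (ε / 2 * |s|) := Real.one_le_exp (by positivity)
  linarith

theorem abs_rpow_le_one_add_sq {H : ℝ} (hH0 : 0 < H) (hH1 : H ≤ 1) (s : ℝ) :
    |s| ^ (2 * H) ≤ 1 + s ^ 2 := by
  rcases le_total |s| 1 with h | h
  · have := Real.rpow_le_one (abs_nonneg s) h (by positivity : 0 ≤ 2 * H)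
    nlinarith [sq_nonneg s]
  · have := Real.rpow_le_rpow_of_exponent_le h (by linarith : 2 * H ≤ 2)
    rw [Real.rpow_two, sq_abs] at this
    linarith

theorem tame_abs_rpow {H : ℝ} (hH0 : 0 < H) (hH1 : H ≤ 1) : Tame fun s => |s| ^ (2 * H) := by
  refine Tame.of_abs_le_sq
    (continuous_abs.rpow_const fun _ => Or.inr (by positivity)) zero_le_one fun s => ?_
  rw [abs_of_nonneg (Real.rpow_nonneg (abs_nonneg s) _), one_mul]
  exact abs_rpow_le_one_add_sq hH0 hH1 s

/-- Shaped for the four terms obtained by multiplying two increments. -/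
theorem integral_sub_add_sub {α : Type*} [MeasurableSpace α] {μ : Measure α} {f g h k : α → ℝ}
    (hf : Integrable f μ) (hg : Integrable g μ) (hh : Integrable h μ) (hk : Integrable k μ) :
    ∫ x, (f x - g x + (h x - k x)) ∂μ =
      ∫ x, f x ∂μ - ∫ x, g x ∂μ + (∫ x, h x ∂μ - ∫ x, k x ∂μ) := by
  rw [← integral_sub hf hg, ← integral_sub hh hk]
  exact integral_add (hf.sub hg) (hh.sub hk)

section Stochastic

variable {Ω : Type*} [MeasurableSpace Ω] {P : Measure Ω}

/-- A process with almost surely continuous paths and measurable marginals has a jointly measurable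
version all of whose paths are continuous. -/
theorem exists_measurable_continuous_version {B : ℝ → Ω → ℝ} (hB : ∀ t, AEMeasurable (B t) P)
    (hc : ∀ᵐ ω ∂P, Continuous fun t => B t ω) :
    ∃ Y : ℝ → Ω → ℝ, Measurable (Function.uncurry Y) ∧ (∀ ω, Continuous fun t => Y t ω) ∧
      ∀ᵐ ω ∂P, ∀ t, Y t ω = B t ω := by
  classical
  have hgood : ∀ᵐ ω ∂P, (Continuous fun t => B t ω) ∧ ∀ q : ℚ, B q ω = (hB q).mk (B q) ω :=
    hc.and (ae_all_iff.2 fun q => (hB q).ae_eq_mk)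
  obtain ⟨G, hGsub, hGm, hG⟩ : ∃ G : Set Ω, (∀ ω ∈ G, (Continuous fun t => B t ω) ∧
      ∀ q : ℚ, B q ω = (hB q).mk (B q) ω) ∧ MeasurableSet G ∧ G ∈ ae P := by
    -- The complement of a measurable hull of the exceptional set is a measurable set of good paths
    -- of full measure.
    obtain ⟨s, hs, h⟩ := eventually_iff_exists_mem.1 hgood
    refine ⟨(toMeasurable P sᶜ)ᶜ, fun ω hω => h ω ?_, (measurableSet_toMeasurable P _).compl, ?_⟩
    · by_contra hn
      exact hω (subset_toMeasurable P _ hn)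
    · rw [mem_ae_iff, compl_compl, measure_toMeasurable]
      exact hs
  refine ⟨fun t => G.indicator (B t), ?_, fun ω => ?_, ?_⟩
  · refine measurable_uncurry_of_continuous_of_measurable (fun ω => ?_) fun t => ?_
    · by_cases hω : ω ∈ G
      · simpa [hω] using (hGsub ω hω).1
      · simpa [hω] using continuous_const
    -- On good paths the value at `t` is a limit of values at rational times, where measurable
    -- modifications are available.
    · obtain ⟨x, hx, hxt⟩ := mem_closure_iff_seq_limit.1 (Rat.denseRange_cast (𝕜 := ℝ) t)
      choose q hq using hx
      refine measurable_of_tendsto_metrizable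
        (f := fun n => G.indicator ((hB (q n)).mk (B (q n))))
        (fun n => (hB (q n)).measurable_mk.indicator hGm) (tendsto_pi_nhds.2 fun ω => ?_)
      by_cases hω : ω ∈ G
      · simp only [Set.indicator_of_mem hω]
        refine (((hGsub ω hω).1.tendsto t).comp hxt).congr fun n => ?_
        rw [← (hGsub ω hω).2, hq]
        rfl
      · simp [hω]
  · by_cases hω : ω ∈ G
    · simpa [hω] using (hGsub ω hω).1
    · simpa [hω] using continuous_const
  · filter_upwards [hG] with ω hω t
    simp [hω]

variable [IsProbabilityMeasure P]

/-- With `|Y| ≤ 1 + Y²`, the quadratic growth of second moments makes `e^{-ε|s|} Y_s` integrable on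
`Ω × ℝ`, hence along almost every path. The countably many `ε = 1/(n+1)` suffice, since the weight
decreases in `ε`. -/
theorem IsSecondOrder.ae_tame {Y : ℝ → Ω → ℝ} (hY : IsSecondOrder P Y)
    (hc : ∀ ω, Continuous fun t => Y t ω) : ∀ᵐ ω ∂P, Tame fun t => Y t ω := by
  obtain ⟨C, hC0, hC⟩ := hY.growth
  have key : ∀ n : ℕ, ∀ᵐ ω ∂P,
      Integrable fun s => Real.exp (-(1 / ((n : ℝ) + 1)) * |s|) * Y s ω := by
    intro n
    have hε : 0 < 1 / ((n : ℝ) + 1) := by positivity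
    set ε := 1 / ((n : ℝ) + 1)
    have hm : Measurable fun p : Ω × ℝ => Real.exp (-ε * |p.2|) * Y p.2 p.1 :=
      (by fun_prop : Measurable fun p : Ω × ℝ => Real.exp (-ε * |p.2|)).mul
        (hY.measurable.comp measurable_swap)
    have hpoly : Integrable fun s : ℝ => Real.exp (-ε * |s|) * (1 + C * (1 + s ^ 2)) :=
      (Tame.of_abs_le_sq (C := 1 + C) (by fun_prop) (by positivity) fun s => by
        rw [abs_of_nonneg (by positivity)]; nlinarith [sq_nonneg s]).integrable ε hε
    have hint : Integrable (fun p : Ω × ℝ => Real.exp (-ε * |p.2|) * Y p.2 p.1)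
        (P.prod volume) := by
      refine ⟨hm.aestronglyMeasurable, ?_⟩
      rw [HasFiniteIntegral, lintegral_prod_symm _ hm.enorm.aemeasurable]
      refine lt_of_le_of_lt (lintegral_mono fun s => ?_) hpoly.lintegral_lt_top
      have hle : ∀ ω, ‖Y s ω‖ₑ ≤ 1 + ‖Y s ω‖ₑ ^ 2 := fun ω => by
        rcases le_total ‖Y s ω‖ₑ 1 with h | h
        · exact h.trans le_self_add
        · exact (le_self_pow h two_ne_zero).trans le_add_self
      have hYs := hY.measurable_apply s
      calc ∫⁻ ω, ‖Real.exp (-ε * |s|) * Y s ω‖ₑ ∂P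
          ≤ ∫⁻ ω, ENNReal.ofReal (Real.exp (-ε * |s|)) * (1 + ‖Y s ω‖ₑ ^ 2) ∂P := by
            refine lintegral_mono fun ω => ?_
            simp only [enorm_mul]
            rw [Real.enorm_eq_ofReal (Real.exp_pos _).le]
            gcongr
            exact hle ω
        _ = ENNReal.ofReal (Real.exp (-ε * |s|)) * (1 + ∫⁻ ω, ‖Y s ω‖ₑ ^ 2 ∂P) := by
            rw [lintegral_const_mul _ (by fun_prop), lintegral_add_left (by fun_prop)]
            simp
        _ ≤ ENNReal.ofReal (Real.exp (-ε * |s|)) *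
            (ENNReal.ofReal 1 + ENNReal.ofReal (C * (1 + s ^ 2))) := by
            rw [ENNReal.ofReal_one]
            gcongr
            exact hC s
        _ = _ := by
            rw [← ENNReal.ofReal_add zero_le_one (by positivity),
              ← ENNReal.ofReal_mul (Real.exp_pos _).le]
    exact hint.prod_right_ae
  filter_upwards [ae_all_iff.2 key] with ω hω
  refine ⟨hc ω, fun ε hε => ?_⟩
  obtain ⟨n, hn⟩ := exists_nat_one_div_lt hε
  refine (hω n).mono (Continuous.aestronglyMeasurable (by have := hc ω; fun_prop))
    (Eventually.of_forall fun s => ?_)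
  rw [norm_mul, norm_mul]
  refine mul_le_mul_of_nonneg_right ?_ (norm_nonneg _)
  simp only [Real.norm_eq_abs, Real.abs_exp]
  apply Real.exp_le_exp.2
  nlinarith [abs_nonneg s]

/-- A jointly measurable version with continuous paths of a fractional Brownian motion. -/
theorem IsFBM.exists_version {H : ℝ} {B : ℝ → Ω → ℝ} (hB : IsFBM P H B) :
    ∃ Y : ℝ → Ω → ℝ, IsSecondOrder P Y ∧ (∀ᵐ ω ∂P, Tame fun t => Y t ω) ∧
      (∀ᵐ ω ∂P, ∀ t, Y t ω = B t ω) ∧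
      ∀ t s, ∫ ω, Y t ω * Y s ω ∂P =
        (1 / 2) * (|t| ^ (2 * H) + |s| ^ (2 * H) - |t - s| ^ (2 * H)) := by
  obtain ⟨Y, hm, hc, hYB⟩ :=
    exists_measurable_continuous_version hB.gaussian.aemeasurable hB.continuous_paths
  have hYt : ∀ t, Y t =ᵐ[P] B t := fun t => hYB.mono fun ω h => h t
  have hcov : ∀ t s, ∫ ω, Y t ω * Y s ω ∂P =
      (1 / 2) * (|t| ^ (2 * H) + |s| ^ (2 * H) - |t - s| ^ (2 * H)) := fun t s =>
    (integral_congr_ae ((hYt t).mul (hYt s))).trans (hB.covariance t s)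
  have hY : IsSecondOrder P Y := by
    refine ⟨hm, ⟨1, zero_le_one, fun t => ?_⟩, fun t =>
      (integral_congr_ae (hYt t)).trans (hB.centred t)⟩
    have hL2 : MemLp (Y t) 2 P :=
      (memLp_congr_ae (hYt t)).2 (hB.gaussian.hasGaussianLaw_eval t).memLp_two
    have h1 : ∫ ω, Y t ω ^ 2 ∂P = |t| ^ (2 * H) := by
      have h2 := hcov t t
      rw [sub_self, abs_zero, Real.zero_rpow (by linarith [hB.hurst_pos])] at h2
      rw [← add_halves (|t| ^ (2 * H))]
      simp only [sq, h2]
      ring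
    have h3 : ∫⁻ ω, ‖Y t ω‖ₑ ^ 2 ∂P = ENNReal.ofReal (|t| ^ (2 * H)) := by
      rw [← h1, ofReal_integral_eq_lintegral_ofReal hL2.integrable_sq
        (Eventually.of_forall fun ω => sq_nonneg _)]
      congr 1
      ext ω
      rw [← enorm_pow, Real.enorm_eq_ofReal (sq_nonneg _)]
    rw [h3, one_mul]
    exact ENNReal.ofReal_le_ofReal (abs_rpow_le_one_add_sq hB.hurst_pos hB.hurst_le_one t)
  exact ⟨Y, hY, hY.ae_tame hc, hYB, hcov⟩

/-! ### Cross-covariances of the transforms. -/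

/-- The cross-covariances of the transforms of a process with the covariance of fractional Brownian
motion. -/
theorem integral_ouTransform_mul {H : ℝ} (hH0 : 0 < H) (hH1 : H ≤ 1)
    {Y : ℝ → Ω → ℝ} (hY : IsSecondOrder P Y) (htame : ∀ᵐ ω ∂P, Tame fun t => Y t ω)
    (hcov : ∀ t s, ∫ ω, Y t ω * Y s ω ∂P =
        (1 / 2) * (|t| ^ (2 * H) + |s| ^ (2 * H) - |t - s| ^ (2 * H)))
    {a b : ℝ} (ha : 0 < a) (hb : 0 < b) (s τ : ℝ) :
    ∫ ω, ouTransform a (fun r => Y r ω) s * ouTransform b (fun r => Y r ω) (s + τ) ∂P =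
      (1 / 2) * ((b * expAvg b (fun x => |x| ^ (2 * H)) τ +
        a * ∫ u, |τ + u| ^ (2 * H) ∂expMeasure a) / (a + b) - |τ| ^ (2 * H)) := by
  have := isProbabilityMeasure_expMeasure ha
  have := isProbabilityMeasure_expMeasure hb
  have hh := tame_abs_rpow hH0 hH1
  set h : ℝ → ℝ := fun x => |x| ^ (2 * H) with hdef
  -- The transform is a mean of increments `Y_r - Y_{r-u}`; in covariances of increments the
  -- nonstationary terms `|t|^{2H} + |s|^{2H}` cancel.
  have hincr : ∀ {c : ℝ}, 0 < c → ∀ r : ℝ,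
      MemLp (fun p : Ω × ℝ => Y r p.1 - Y (r - p.2) p.1) 2 (P.prod (expMeasure c)) := by
    intro c hc r
    have := isProbabilityMeasure_expMeasure hc
    exact ((hY.memLp r).comp_measurePreserving measurePreserving_fst).sub (hY.memLp_shift hc r)
  have hou : ∀ {c : ℝ}, 0 < c → ∀ r : ℝ, ∀ᵐ ω ∂P, ouTransform c (fun x => Y x ω) r =
      ∫ u, (Y r ω - Y (r - u) ω) ∂expMeasure c := by
    intro c hc r
    have := isProbabilityMeasure_expMeasure hc
    filter_upwards [htame] with ω hω
    rw [integral_sub (integrable_const _) (hω.integrable_sub hc r)]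
    simp [ouTransform, expAvg]
  have hprod : ∀ r t : ℝ, Integrable (fun ω => Y r ω * Y t ω) P := fun r t =>
    (hY.memLp r).integrable_mul (hY.memLp t)
  have hDD : ∀ u v, ∫ ω, (Y s ω - Y (s - u) ω) * (Y (s + τ) ω - Y (s + τ - v) ω) ∂P =
      (1 / 2) * (h (τ - v) - h τ + (h (τ + u) - h (τ + u - v))) := by
    intro u v
    have h1 : ∀ ω, (Y s ω - Y (s - u) ω) * (Y (s + τ) ω - Y (s + τ - v) ω) =
        Y (s + τ) ω * Y s ω - Y (s + τ - v) ω * Y s ω +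
          (Y (s + τ - v) ω * Y (s - u) ω - Y (s + τ) ω * Y (s - u) ω) := fun ω => by ring
    simp only [h1]
    rw [integral_sub_add_sub (hprod _ _) (hprod _ _) (hprod _ _) (hprod _ _), hcov, hcov, hcov,
      hcov, hdef]
    simp only
    rw [show s + τ - s = τ by ring, show s + τ - v - s = τ - v by ring,
      show s + τ - (s - u) = τ + u by ring, show s + τ - v - (s - u) = τ + u - v by ring]
    ring
  have hstep : ∫ ω, ouTransform a (fun r => Y r ω) s * ouTransform b (fun r => Y r ω) (s + τ) ∂P =
      ∫ u, ∫ v, (1 / 2) * (h (τ - v) - h τ + (h (τ + u) - h (τ + u - v)))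
        ∂expMeasure b ∂expMeasure a := by
    refine (integral_congr_ae (EventuallyEq.mul (hou ha s) (hou hb (s + τ)))).trans ?_
    refine (integral_mul_integral (U := fun u ω => Y s ω - Y (s - u) ω)
      (V := fun v ω => Y (s + τ) ω - Y (s + τ - v) ω) (hincr ha s) (hincr hb (s + τ))).trans ?_
    simp only [hDD]
  have hinner : ∀ u, ∫ v, (1 / 2) * (h (τ - v) - h τ + (h (τ + u) - h (τ + u - v))) ∂expMeasure b =
      (1 / 2) * (expAvg b h τ - h τ + (h (τ + u) - expAvg b h (τ + u))) := by
    intro u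
    rw [integral_const_mul, integral_sub_add_sub (hh.integrable_sub hb τ) (integrable_const _)
      (integrable_const _) (hh.integrable_sub hb (τ + u))]
    simp [expAvg]
  rw [hstep]
  simp only [hinner]
  have hE := hh.expAvg hb
  rw [integral_const_mul, integral_sub_add_sub (integrable_const _) (integrable_const _)
    (hh.integrable_add ha τ) (hE.integrable_add ha τ)]
  -- This replaces the mean of `h (τ + u - v)` over both variables by the two one-sided means.
  have hE2 := hh.integral_expAvg_add ha hb τ
  have hab : a + b ≠ 0 := by positivity
  rw [← mul_div_cancel_left₀ (∫ u, expAvg b h (τ + u) ∂expMeasure a) hab, hE2]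
  simp only [integral_const, probReal_univ, one_smul]
  field_simp
  ring

end Stochastic

/-! ### The function `f_H`: regularity and representation by exponential averages. -/

theorem intervalIntegrable_mul_rpow {H : ℝ} (hH0 : 0 < H) {φ : ℝ → ℝ} (hφ : Continuous φ)
    (x y : ℝ) : IntervalIntegrable (fun s => φ s * s ^ (2 * H - 1)) volume x y :=
  (intervalIntegral.intervalIntegrable_rpow' (by linarith)).continuousOn_mul hφ.continuousOn

theorem hasDerivAt_integral_mul_rpow {H : ℝ} (hH0 : 0 < H) {φ : ℝ → ℝ} (hφ : Continuous φ)
    {x : ℝ} (hx : 0 < x) :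
    HasDerivAt (fun x => ∫ s in (0 : ℝ)..x, φ s * s ^ (2 * H - 1)) (φ x * x ^ (2 * H - 1)) x := by
  refine intervalIntegral.integral_hasDerivAt_right (intervalIntegrable_mul_rpow hH0 hφ 0 x) ?_ ?_
  · exact (hφ.measurable.mul (by fun_prop)).stronglyMeasurable.stronglyMeasurableAtFilter
  · exact hφ.continuousAt.mul (Real.continuousAt_rpow_const _ _ (Or.inl hx.ne'))

theorem hasDerivAt_fH {H : ℝ} (hH0 : 0 < H) {x : ℝ} (hx : 0 < x) :
    HasDerivAt (fH H)
      (Real.exp x * (Real.Gamma (2 * H) - ∫ s in (0 : ℝ)..x, Real.exp (-s) * s ^ (2 * H - 1)) -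
        Real.exp (-x) * (Real.Gamma (2 * H) - ∫ s in (0 : ℝ)..x, Real.exp s * s ^ (2 * H - 1)) -
        2 * x ^ (2 * H - 1)) x := by
  have h1 := (hasDerivAt_integral_mul_rpow hH0 Real.continuous_exp hx).const_sub
    (Real.Gamma (2 * H))
  have h2 := (hasDerivAt_integral_mul_rpow hH0 (φ := fun s => Real.exp (-s)) (by fun_prop)
    hx).const_sub (Real.Gamma (2 * H))
  have h3 : HasDerivAt (fun x => Real.exp (-x)) (-Real.exp (-x)) x := by
    simpa using (hasDerivAt_neg x).exp
  convert! (h3.mul h1).add ((Real.hasDerivAt_exp x).mul h2) using 1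
  have h4 : Real.exp (-x) * Real.exp x = 1 := by rw [← Real.exp_add]; simp
  linear_combination (2 * x ^ (2 * H - 1)) * h4

theorem deriv_fH {H : ℝ} (hH0 : 0 < H) {x : ℝ} (hx : 0 < x) :
    deriv (fH H) x =
      Real.exp x * (Real.Gamma (2 * H) - ∫ s in (0 : ℝ)..x, Real.exp (-s) * s ^ (2 * H - 1)) -
        Real.exp (-x) * (Real.Gamma (2 * H) - ∫ s in (0 : ℝ)..x, Real.exp s * s ^ (2 * H - 1)) -
        2 * x ^ (2 * H - 1) :=
  (hasDerivAt_fH hH0 hx).deriv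

/-- The power terms from the two integrals cancel this time, leaving a differential equation that
exhibits `f_H''` as continuous. -/
theorem hasDerivAt_deriv_fH {H : ℝ} (hH0 : 0 < H) {x : ℝ} (hx : 0 < x) :
    HasDerivAt (deriv (fH H)) (fH H x - 2 * ((2 * H - 1) * x ^ (2 * H - 2))) x := by
  have h1 := (hasDerivAt_integral_mul_rpow hH0 Real.continuous_exp hx).const_sub
    (Real.Gamma (2 * H))
  have h2 := (hasDerivAt_integral_mul_rpow hH0 (φ := fun s => Real.exp (-s)) (by fun_prop)
    hx).const_sub (Real.Gamma (2 * H))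
  have h3 : HasDerivAt (fun x => Real.exp (-x)) (-Real.exp (-x)) x := by
    simpa using (hasDerivAt_neg x).exp
  have h5 := (Real.hasDerivAt_rpow_const (p := 2 * H - 1) (Or.inl hx.ne')).const_mul 2
  refine HasDerivAt.congr_of_eventuallyEq ?_
    ((eventually_gt_nhds hx).mono fun y hy => deriv_fH hH0 hy)
  convert! (((Real.hasDerivAt_exp x).mul h2).sub (h3.mul h1)).sub h5 using 1
  rw [show 2 * H - 1 - 1 = 2 * H - 2 by ring, fH]
  ring

theorem contDiffOn_fH {H : ℝ} (hH0 : 0 < H) : ContDiffOn ℝ 2 (fH H) (Set.Ioi 0) := by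
  rw [show (2 : WithTop ℕ∞) = 1 + 1 by norm_num, contDiffOn_succ_iff_deriv_of_isOpen isOpen_Ioi]
  refine ⟨fun x hx => (hasDerivAt_fH hH0 hx).differentiableAt.differentiableWithinAt, by simp, ?_⟩
  rw [show (1 : WithTop ℕ∞) = 0 + 1 by norm_num, contDiffOn_succ_iff_deriv_of_isOpen isOpen_Ioi]
  refine ⟨fun x hx => (hasDerivAt_deriv_fH hH0 hx).differentiableAt.differentiableWithinAt,
    by simp, contDiffOn_zero.2 ?_⟩
  refine ContinuousOn.congr (f := fun x => fH H x - 2 * ((2 * H - 1) * x ^ (2 * H - 2)))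
    (fun x hx => ?_) fun x hx => (hasDerivAt_deriv_fH hH0 hx).deriv
  refine ContinuousAt.continuousWithinAt ((hasDerivAt_fH hH0 hx).continuousAt.sub ?_)
  exact ((Real.continuousAt_rpow_const _ _ (Or.inl (ne_of_gt hx))).const_mul _).const_mul _

theorem integral_Iic_exp_mul_abs_rpow {H : ℝ} (hH0 : 0 < H) :
    ∫ s in Set.Iic (0 : ℝ), Real.exp s * |s| ^ (2 * H) = 2 * H * Real.Gamma (2 * H) := by
  rw [← Real.Gamma_add_one (by positivity), Real.Gamma_eq_integral (by positivity)]
  have h := integral_comp_neg_Ioi 0 fun s => Real.exp s * |s| ^ (2 * H)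
  rw [neg_zero] at h
  rw [← h]
  refine setIntegral_congr_fun measurableSet_Ioi fun s hs => ?_
  rw [abs_neg, abs_of_pos hs, add_sub_cancel_right]

theorem integral_exp_mul_rpow {H : ℝ} (hH0 : 0 < H) {x : ℝ} (hx : 0 ≤ x) (c : ℝ) :
    c * (∫ s in (0 : ℝ)..x, Real.exp (c * s) * s ^ (2 * H)) =
      Real.exp (c * x) * x ^ (2 * H) -
        2 * H * ∫ s in (0 : ℝ)..x, Real.exp (c * s) * s ^ (2 * H - 1) := by
  have hc1 : Continuous fun s : ℝ => Real.exp (c * s) := by fun_prop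
  have hc2 : Continuous fun s : ℝ => s ^ (2 * H) := Real.continuous_rpow_const (by positivity)
  have hc : Continuous fun s : ℝ => Real.exp (c * s) * s ^ (2 * H) := hc1.mul hc2
  have hi1 := (hc.intervalIntegrable (μ := volume) 0 x).const_mul c
  have hi2 := (intervalIntegrable_mul_rpow hH0 hc1 0 x).const_mul (2 * H)
  -- This form asks for the derivative only in the open interval: `s ^ (2 * H)` need not be
  -- differentiable at `0`.
  have h := intervalIntegral.integral_eq_sub_of_hasDerivAt_of_le hx
    (f := fun s => Real.exp (c * s) * s ^ (2 * H))
    (f' := fun s => c * (Real.exp (c * s) * s ^ (2 * H)) +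
      2 * H * (Real.exp (c * s) * s ^ (2 * H - 1)))
    hc.continuousOn (fun s hs => ?_) (hi1.add hi2)
  · rw [intervalIntegral.integral_add hi1 hi2, intervalIntegral.integral_const_mul,
      intervalIntegral.integral_const_mul] at h
    simp only [Real.zero_rpow (show 2 * H ≠ 0 by positivity), mul_zero, sub_zero] at h
    linarith
  · have h1 : HasDerivAt (fun s => Real.exp (c * s)) (Real.exp (c * s) * c) s := by
      simpa using ((hasDerivAt_id s).const_mul c).exp
    have h2 := Real.hasDerivAt_rpow_const (p := 2 * H) (Or.inl (ne_of_gt hs.1))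
    convert! h1.mul h2 using 1
    ring

/-- Split `∫ e^s |s|^{2H}` over `(-∞, ±x]` at `0`. The half-line gives `Γ(2H + 1) = 2H Γ(2H)`;
integrating the rest by parts gives one of the two summands of `f_H` for each sign. -/
theorem expAvg_one_abs_rpow {H : ℝ} (hH0 : 0 < H) (hH1 : H ≤ 1) {x : ℝ} (hx : 0 ≤ x) :
    expAvg 1 (fun s => |s| ^ (2 * H)) x + expAvg 1 (fun s => |s| ^ (2 * H)) (-x) =
      2 * x ^ (2 * H) + 2 * H * fH H x := by
  have hh := tame_abs_rpow hH0 hH1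
  have key : ∀ y, expAvg 1 (fun s => |s| ^ (2 * H)) y = Real.exp (-y) *
      (2 * H * Real.Gamma (2 * H) + ∫ s in (0 : ℝ)..y, Real.exp s * |s| ^ (2 * H)) := by
    intro y
    have h0 := hh.integrableOn_Iic one_pos 0
    have hy := hh.integrableOn_Iic one_pos y
    rw [expAvg_eq_integral_Iic one_pos, ← integral_Iic_exp_mul_abs_rpow hH0]
    simp only [one_mul, neg_mul] at h0 hy ⊢
    rw [← intervalIntegral.integral_Iic_sub_Iic h0 hy]
    ring
  have h1 : ∫ s in (0 : ℝ)..x, Real.exp s * |s| ^ (2 * H) =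
      Real.exp x * x ^ (2 * H) - 2 * H * ∫ s in (0 : ℝ)..x, Real.exp s * s ^ (2 * H - 1) := by
    have := integral_exp_mul_rpow hH0 hx 1
    simp only [one_mul] at this
    rw [← this]
    refine intervalIntegral.integral_congr fun s hs => ?_
    rw [Set.uIcc_of_le hx] at hs
    rw [abs_of_nonneg hs.1]
  have h2 : ∫ s in (0 : ℝ)..-x, Real.exp s * |s| ^ (2 * H) =
      Real.exp (-x) * x ^ (2 * H) -
        2 * H * ∫ s in (0 : ℝ)..x, Real.exp (-s) * s ^ (2 * H - 1) := by
    have := integral_exp_mul_rpow hH0 hx (-1)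
    simp only [neg_mul, one_mul] at this
    have hneg := intervalIntegral.integral_comp_neg (a := 0) (b := x)
      fun s => Real.exp s * |s| ^ (2 * H)
    rw [neg_zero] at hneg
    rw [intervalIntegral.integral_symm, ← hneg, ← this]
    congr 1
    refine intervalIntegral.integral_congr fun s hs => ?_
    rw [Set.uIcc_of_le hx] at hs
    rw [abs_neg, abs_of_nonneg hs.1]
  rw [key, key, h1, h2, fH, neg_neg]
  have h4 : Real.exp (-x) * Real.exp x = 1 := by rw [← Real.exp_add]; simp
  linear_combination (2 * x ^ (2 * H)) * h4

theorem integral_expMeasure_scale {a : ℝ} (ha : 0 < a) (f : ℝ → ℝ) :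
    ∫ u, f u ∂expMeasure a = ∫ u, f (u / a) ∂expMeasure 1 := by
  rw [integral_expMeasure ha, integral_expMeasure one_pos]
  have h := integral_comp_mul_left_Ioi (fun u => 1 * Real.exp (-1 * u) * f (u / a)) 0 ha
  rw [mul_zero, smul_eq_mul, eq_inv_mul_iff_mul_eq₀ ha.ne', ← integral_const_mul] at h
  rw [← h]
  congr 1
  ext u
  rw [mul_div_cancel_left₀ _ ha.ne']
  ring_nf

/-- The function `f_H` as a symmetrised exponential average of `|x|^{2H}`. -/
theorem expAvg_add_reflected_abs_rpow {H : ℝ} (hH0 : 0 < H) (hH1 : H ≤ 1) {a : ℝ} (ha : 0 < a)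
    {τ : ℝ} (hτ : 0 ≤ τ) :
    expAvg a (fun s => |s| ^ (2 * H)) τ + ∫ u, |τ + u| ^ (2 * H) ∂expMeasure a =
      2 * |τ| ^ (2 * H) + 2 * H * a ^ (-(2 * H)) * fH H (a * τ) := by
  have hs : ∀ x : ℝ, |x| ^ (2 * H) = a ^ (-(2 * H)) * |a * x| ^ (2 * H) := by
    intro x
    rw [abs_mul, abs_of_pos ha, Real.mul_rpow ha.le (abs_nonneg x), ← mul_assoc,
      ← Real.rpow_add ha]
    simp
  have h := expAvg_one_abs_rpow hH0 hH1 (mul_nonneg ha.le hτ)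
  have h1 : expAvg a (fun s => |s| ^ (2 * H)) τ =
      a ^ (-(2 * H)) * expAvg 1 (fun s => |s| ^ (2 * H)) (a * τ) := by
    rw [expAvg, expAvg, integral_expMeasure_scale ha, ← integral_const_mul]
    congr 1
    ext u
    rw [hs, mul_sub, mul_div_cancel₀ _ ha.ne']
  have h2 : ∫ u, |τ + u| ^ (2 * H) ∂expMeasure a =
      a ^ (-(2 * H)) * expAvg 1 (fun s => |s| ^ (2 * H)) (-(a * τ)) := by
    rw [expAvg, integral_expMeasure_scale ha, ← integral_const_mul]
    congr 1
    ext u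
    rw [hs, mul_add, mul_div_cancel₀ _ ha.ne', ← abs_neg, neg_add, sub_eq_add_neg]
  rw [h1, h2, ← mul_add, h, hs τ, abs_of_nonneg (mul_nonneg ha.le hτ)]
  ring

/-! ### Confluent limits of the covariance formulas. -/

/-- At `t = 0` the function of `x` is constant, and the factor `t` removes the value of `deriv (fH
H)` at `0`, whatever it is. -/
theorem hasDerivAt_fH_mul {H : ℝ} (hH0 : 0 < H) {t x : ℝ} (ht : 0 ≤ t) (hx : 0 < x) :
    HasDerivAt (fun x => fH H (x * t)) (t * deriv (fH H) (x * t)) x := by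
  rcases ht.eq_or_lt with rfl | ht
  · simpa using hasDerivAt_const x (fH H 0)
  · have h1 := (hasDerivAt_fH hH0 (mul_pos hx ht)).differentiableAt.hasDerivAt
    have h2 := h1.comp x (hasDerivAt_mul_const t)
    rwa [mul_comm] at h2

theorem hasDerivAt_deriv_fH_mul {H : ℝ} (hH0 : 0 < H) {t x : ℝ} (ht : 0 ≤ t) (hx : 0 < x) :
    HasDerivAt (fun x => t * deriv (fH H) (x * t)) (t ^ 2 * deriv (deriv (fH H)) (x * t)) x := by
  rcases ht.eq_or_lt with rfl | ht
  · simpa using hasDerivAt_const x (0 : ℝ)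
  · have h1 := (hasDerivAt_deriv_fH hH0 (mul_pos hx ht)).differentiableAt.hasDerivAt
    convert! (h1.comp x (hasDerivAt_mul_const t)).const_mul t using 1
    ring

theorem rpow_sub_two_mul {x : ℝ} (hx : 0 < x) (n : ℕ) (H : ℝ) :
    x ^ ((n : ℝ) - 2 * H) = x ^ n * x ^ (-(2 * H)) := by
  rw [sub_eq_add_neg, Real.rpow_add hx, Real.rpow_natCast]

/-- The numerator `x^{4-2H} f_H(x t)`, whose divided differences in `x²` are the autocovariances. -/
noncomputable def covNumer (H t x : ℝ) : ℝ := x ^ (4 - 2 * H) * fH H (x * t)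

/-- The derivative of `covNumer H t` with respect to `x²`. -/
noncomputable def covNumerDeriv (H t x : ℝ) : ℝ :=
  (2 - H) * x ^ (2 - 2 * H) * fH H (x * t) + x ^ (3 - 2 * H) * t * deriv (fH H) (x * t) / 2

theorem hasDerivAt_covNumer {H : ℝ} (hH0 : 0 < H) {t x : ℝ} (ht : 0 ≤ t) (hx : 0 < x) :
    HasDerivAt (covNumer H t) (2 * x * covNumerDeriv H t x) x := by
  have h1 := Real.hasDerivAt_rpow_const (p := 4 - 2 * H) (Or.inl hx.ne')
  convert! h1.mul (hasDerivAt_fH_mul hH0 ht hx) using 1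
  have e2 := rpow_sub_two_mul hx 2 H
  have e3 := rpow_sub_two_mul hx 3 H
  have e4 := rpow_sub_two_mul hx 4 H
  push_cast at e2 e3 e4
  rw [covNumerDeriv, show 4 - 2 * H - 1 = 3 - 2 * H by ring, e2, e3, e4]
  ring

theorem hasDerivAt_covNumerDeriv {H : ℝ} (hH0 : 0 < H) {t x : ℝ} (ht : 0 ≤ t) (hx : 0 < x) :
    HasDerivAt (covNumerDeriv H t) (2 * x * (x ^ (-(2 * H)) *
      ((2 - H) * (1 - H) * fH H (x * t) + (7 - 4 * H) * (x * t / 4) * deriv (fH H) (x * t) +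
      x ^ 2 * t ^ 2 / 4 * deriv (deriv (fH H)) (x * t)))) x := by
  have h2 := (Real.hasDerivAt_rpow_const (p := 2 - 2 * H) (Or.inl hx.ne')).const_mul (2 - H)
  have h3 := Real.hasDerivAt_rpow_const (p := 3 - 2 * H) (Or.inl hx.ne')
  have h4 := (h2.mul (hasDerivAt_fH_mul hH0 ht hx)).add
    ((h3.mul (hasDerivAt_deriv_fH_mul hH0 ht hx)).div_const 2)
  have hfun : covNumerDeriv H t = (fun x => (2 - H) * x ^ (2 - 2 * H) * fH H (x * t) +
      x ^ (3 - 2 * H) * (t * deriv (fH H) (x * t)) / 2) := by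
    ext x
    rw [covNumerDeriv, mul_assoc (x ^ (3 - 2 * H))]
  rw [hfun]
  convert! h4 using 1
  have e1 := rpow_sub_two_mul hx 1 H
  have e2 := rpow_sub_two_mul hx 2 H
  have e3 := rpow_sub_two_mul hx 3 H
  push_cast at e1 e2 e3
  rw [show 2 - 2 * H - 1 = 1 - 2 * H by ring, show 3 - 2 * H - 1 = 2 - 2 * H by ring, e1, e2, e3]
  ring

theorem autocovDistinct_eq (α β γ σ H t : ℝ) : autocovDistinct α β γ σ H t = σ ^ 2 * H / 2 *
    (covNumer H t α / ((α ^ 2 - β ^ 2) * (α ^ 2 - γ ^ 2)) +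
      covNumer H t β / ((β ^ 2 - α ^ 2) * (β ^ 2 - γ ^ 2)) +
      covNumer H t γ / ((γ ^ 2 - α ^ 2) * (γ ^ 2 - β ^ 2))) := rfl

theorem autocovDouble_eq (α β σ H t : ℝ) : autocovDouble α β σ H t = σ ^ 2 * H / 2 *
    ((covNumer H t β - covNumer H t α + covNumerDeriv H t α * (α ^ 2 - β ^ 2)) /
      (α ^ 2 - β ^ 2) ^ 2) := rfl

theorem sq_sub_sq_ne_zero {x y : ℝ} (hx : 0 < x) (hy : 0 < y) (h : x ≠ y) :
    x ^ 2 - y ^ 2 ≠ 0 := by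
  rw [sq_sub_sq]
  exact mul_ne_zero (by positivity) (sub_ne_zero.2 h)

/-- With `K(x) = N(x) / (x² - β²)` and `N = covNumer H t`, the two terms singular at `γ = α` add up
to `(K(γ) - K(α)) / (γ² - α²)`, a slope of `K` divided by `α + γ`. -/
theorem tendsto_autocovDistinct {H : ℝ} (hH0 : 0 < H) (σ : ℝ) {α β t : ℝ} (hα : 0 < α)
    (hβ : 0 < β) (hαβ : α ≠ β) (ht : 0 ≤ t) :
    Tendsto (fun γ => autocovDistinct α β γ σ H t) (𝓝[≠] α) (𝓝 (autocovDouble α β σ H t)) := by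
  have hne := sq_sub_sq_ne_zero hα hβ hαβ
  have hK : HasDerivAt (fun x => covNumer H t x / (x ^ 2 - β ^ 2))
      ((2 * α * covNumerDeriv H t α * (α ^ 2 - β ^ 2) - covNumer H t α * (2 * α)) /
        (α ^ 2 - β ^ 2) ^ 2) α := by
    convert! (hasDerivAt_covNumer hH0 ht hα).div (((hasDerivAt_id α).pow 2).sub_const (β ^ 2)) hne
      using 1
    simp
  have h1 := hasDerivAt_iff_tendsto_slope.1 hK
  have hid : Tendsto (fun γ : ℝ => γ) (𝓝[≠] α) (𝓝 α) :=
    tendsto_nhdsWithin_of_tendsto_nhds tendsto_id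
  have hsum : Tendsto (fun γ => α + γ) (𝓝[≠] α) (𝓝 (α + α)) := hid.const_add α
  have h2 := h1.div hsum (by positivity)
  have h3 : Tendsto (fun γ => covNumer H t β / ((β ^ 2 - α ^ 2) * (β ^ 2 - γ ^ 2))) (𝓝[≠] α)
      (𝓝 (covNumer H t β / ((β ^ 2 - α ^ 2) * (β ^ 2 - α ^ 2)))) := by
    refine tendsto_const_nhds.div (((hid.pow 2).const_sub _).const_mul _) ?_
    have : β ^ 2 - α ^ 2 ≠ 0 := sq_sub_sq_ne_zero hβ hα hαβ.symm
    exact mul_ne_zero this this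
  have h4 := (h2.add h3).const_mul (σ ^ 2 * H / 2)
  have hval : autocovDouble α β σ H t = σ ^ 2 * H / 2 *
      ((2 * α * covNumerDeriv H t α * (α ^ 2 - β ^ 2) - covNumer H t α * (2 * α)) /
        (α ^ 2 - β ^ 2) ^ 2 / (α + α) +
        covNumer H t β / ((β ^ 2 - α ^ 2) * (β ^ 2 - α ^ 2))) := by
    rw [autocovDouble_eq, show (β ^ 2 - α ^ 2) * (β ^ 2 - α ^ 2) = (α ^ 2 - β ^ 2) ^ 2 by ring]
    field_simp
    ring
  rw [hval]
  refine h4.congr' ?_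
  have hpos : ∀ᶠ γ in 𝓝[≠] α, 0 < γ := (eventually_gt_nhds hα).filter_mono nhdsWithin_le_nhds
  have hneβ : ∀ᶠ γ in 𝓝[≠] α, γ ≠ β := (eventually_ne_nhds hαβ).filter_mono nhdsWithin_le_nhds
  filter_upwards [self_mem_nhdsWithin, hpos, hneβ] with γ hγα hγ hγβ
  have h5 : γ ^ 2 - β ^ 2 ≠ 0 := sq_sub_sq_ne_zero hγ hβ hγβ
  have h6 : γ - α ≠ 0 := sub_ne_zero.2 hγα
  have h7 : α + γ ≠ 0 := by positivity
  rw [autocovDistinct_eq, Pi.div_apply, slope_def_field,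
    show γ ^ 2 - α ^ 2 = (γ - α) * (α + γ) by ring,
    show α ^ 2 - γ ^ 2 = -((γ - α) * (α + γ)) by ring]
  congr 1
  rw [add_right_comm]
  congr 1
  field_simp
  ring

/-- The limit is the second Taylor coefficient of `covNumer H t` in the variable `x²`. One use of
l'Hôpital's rule leaves a difference quotient of `covNumerDeriv H t`. -/
theorem tendsto_autocovDouble {H : ℝ} (hH0 : 0 < H) (σ : ℝ) {α t : ℝ} (hα : 0 < α) (ht : 0 ≤ t) :
    Tendsto (fun β => autocovDouble α β σ H t) (𝓝[≠] α) (𝓝 (autocovTriple α σ H t)) := by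
  have hid : Tendsto (fun γ : ℝ => γ) (𝓝[≠] α) (𝓝 α) :=
    tendsto_nhdsWithin_of_tendsto_nhds tendsto_id
  have hpos : ∀ᶠ γ in 𝓝[≠] α, 0 < γ := (eventually_gt_nhds hα).filter_mono nhdsWithin_le_nhds
  have hD := hasDerivAt_covNumerDeriv hH0 ht hα
  set L := α ^ (-(2 * H)) *
      ((2 - H) * (1 - H) * fH H (α * t) + (7 - 4 * H) * (α * t / 4) * deriv (fH H) (α * t) +
      α ^ 2 * t ^ 2 / 4 * deriv (deriv (fH H)) (α * t)) with hL
  have hval : autocovTriple α σ H t = σ ^ 2 * H / 2 * (L / 2) := by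
    rw [autocovTriple, hL, Real.rpow_neg hα.le]
    have := (Real.rpow_pos_of_pos hα (2 * H)).ne'
    field_simp
    ring
  rw [hval]
  simp only [autocovDouble_eq]
  refine Tendsto.const_mul _ ?_
  refine HasDerivAt.lhopital_zero_nhdsNE
    (f' := fun x => 2 * x * covNumerDeriv H t x - 2 * x * covNumerDeriv H t α)
    (g' := fun x => -(4 * x * (α ^ 2 - x ^ 2))) ?_ ?_ ?_ ?_ ?_ ?_
  · filter_upwards [hpos] with x hx
    have h1 := (((hasDerivAt_id x).pow 2).const_sub (α ^ 2)).const_mul (covNumerDeriv H t α)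
    convert! ((hasDerivAt_covNumer hH0 ht hx).sub_const (covNumer H t α)).add h1 using 1
    simp
    ring
  · filter_upwards with x
    convert! (((hasDerivAt_id x).pow 2).const_sub (α ^ 2)).pow 2 using 1
    simp
    ring
  · filter_upwards [hpos, self_mem_nhdsWithin] with x hx hxα
    exact neg_ne_zero.2 (mul_ne_zero (by positivity) (sq_sub_sq_ne_zero hα hx (Ne.symm hxα)))
  · have h1 : Tendsto (covNumer H t) (𝓝[≠] α) (𝓝 (covNumer H t α)) :=
      tendsto_nhdsWithin_of_tendsto_nhds (hasDerivAt_covNumer hH0 ht hα).continuousAt.tendsto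
    convert! (h1.sub_const (covNumer H t α)).add
      (((hid.pow 2).const_sub (α ^ 2)).const_mul (covNumerDeriv H t α)) using 2
    ring
  · convert! ((hid.pow 2).const_sub (α ^ 2)).pow 2 using 2
    ring
  -- After cancelling `2x`, the quotient of derivatives is the slope of `covNumerDeriv H t` at `α`
  -- over `2 (α + x)`.
  · have h2 : Tendsto (fun x => 2 * (α + x)) (𝓝[≠] α) (𝓝 (2 * (α + α))) :=
      (hid.const_add α).const_mul 2
    have h1 := (hasDerivAt_iff_tendsto_slope.1 hD).div h2 (by positivity)
    have hlim : 2 * α * L / (2 * (α + α)) = L / 2 := by field_simp; ring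
    rw [hlim] at h1
    refine h1.congr' ?_
    filter_upwards [hpos, self_mem_nhdsWithin] with x hx hxα
    have h3 : x - α ≠ 0 := sub_ne_zero.2 hxα
    have h4 : α + x ≠ 0 := by positivity
    simp only [Pi.div_apply]
    rw [slope_def_field, show α ^ 2 - x ^ 2 = -((x - α) * (α + x)) by ring]
    field_simp
    ring

/-! ### Partial fractions for compositions of transforms. -/

namespace Tame

variable {y : ℝ → ℝ} {a b c : ℝ}

theorem ouTransform_ouTransform (hy : Tame y) (ha : 0 < a) (hb : 0 < b) (t : ℝ) :
    (a - b) * _root_.ouTransform a (_root_.ouTransform b y) t =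
      a * _root_.ouTransform a y t - b * _root_.ouTransform b y t := by
  have h1 : _root_.expAvg a (_root_.ouTransform b y) t =
      _root_.expAvg a y t - _root_.expAvg a (_root_.expAvg b y) t :=
    integral_sub (hy.integrable_sub ha t) ((hy.expAvg hb).integrable_sub ha t)
  have h2 := hy.expAvg_expAvg ha hb t
  have h3 : _root_.ouTransform a (_root_.ouTransform b y) t =
      y t - _root_.expAvg b y t -
        (_root_.expAvg a y t - _root_.expAvg a (_root_.expAvg b y) t) := by
    rw [← h1]
    rfl
  rw [h3, _root_.ouTransform, _root_.ouTransform]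
  linear_combination h2

theorem ouTransform_comm (hy : Tame y) (ha : 0 < a) (hb : 0 < b) :
    _root_.ouTransform a (_root_.ouTransform b y) =
      _root_.ouTransform b (_root_.ouTransform a y) := by
  rcases eq_or_ne a b with rfl | hab
  · rfl
  · ext t
    refine mul_left_cancel₀ (sub_ne_zero.2 hab) ?_
    linear_combination hy.ouTransform_ouTransform ha hb t + hy.ouTransform_ouTransform hb ha t

/-- Partial fractions for the composition of three transforms with distinct rates. -/
theorem ouTransform_three (hy : Tame y) (ha : 0 < a) (hb : 0 < b) (hc : 0 < c) (hab : a ≠ b)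
    (hac : a ≠ c) (hbc : b ≠ c) (t : ℝ) :
    _root_.ouTransform a (_root_.ouTransform b (_root_.ouTransform c y)) t =
      a ^ 2 / ((a - b) * (a - c)) * _root_.ouTransform a y t +
        b ^ 2 / ((b - a) * (b - c)) * _root_.ouTransform b y t +
        c ^ 2 / ((c - a) * (c - b)) * _root_.ouTransform c y t := by
  have h1 := (hy.ouTransform hc).ouTransform_ouTransform ha hb t
  have h2 := hy.ouTransform_ouTransform ha hc t
  have h3 := hy.ouTransform_ouTransform hb hc t
  have hab' := sub_ne_zero.2 hab
  have hac' := sub_ne_zero.2 hac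
  have hbc' := sub_ne_zero.2 hbc
  rw [mul_comm, ← eq_div_iff (by assumption)] at h1 h2 h3
  rw [h1, h2, h3, ← neg_sub a b, ← neg_sub a c, ← neg_sub b c]
  field_simp
  ring

end Tame

theorem ouTransform_const_mul (a σ : ℝ) (y : ℝ → ℝ) :
    ouTransform a (fun s => σ * y s) = fun t => σ * ouTransform a y t := by
  ext t
  rw [ouTransform, ouTransform, expAvg, integral_const_mul, mul_sub, expAvg]

theorem foldr_ouTransform_const_mul (rs : List ℝ) (σ : ℝ) (y : ℝ → ℝ) :
    rs.foldr ouTransform (fun s => σ * y s) = fun t => σ * rs.foldr ouTransform y t := by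
  induction rs with
  | nil => rfl
  | cons r rs ih => rw [List.foldr_cons, ih, ouTransform_const_mul, List.foldr_cons]

/-- Adding the terms for `(i, j)` and `(j, i)` pairs each left mean `Eᵢ` with the right mean `Fᵢ`.
Substituting `Eᵢ + Fᵢ = 2h + Gᵢ` then cancels `h`, for any weights `p`, `q`, `r`. -/
theorem double_sum_partial_fractions {a b c : ℝ} (ha : 0 < a) (hb : 0 < b) (hc : 0 < c)
    (p q r E₁ E₂ E₃ F₁ F₂ F₃ h G₁ G₂ G₃ : ℝ) (h₁ : E₁ + F₁ = 2 * h + G₁)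
    (h₂ : E₂ + F₂ = 2 * h + G₂) (h₃ : E₃ + F₃ = 2 * h + G₃) :
    p * p * (1 / 2 * ((a * E₁ + a * F₁) / (a + a) - h)) +
      p * q * (1 / 2 * ((b * E₂ + a * F₁) / (a + b) - h)) +
      p * r * (1 / 2 * ((c * E₃ + a * F₁) / (a + c) - h)) +
      (q * p * (1 / 2 * ((a * E₁ + b * F₂) / (b + a) - h)) +
      q * q * (1 / 2 * ((b * E₂ + b * F₂) / (b + b) - h)) +
      q * r * (1 / 2 * ((c * E₃ + b * F₂) / (b + c) - h))) +
      (r * p * (1 / 2 * ((a * E₁ + c * F₃) / (c + a) - h)) +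
      r * q * (1 / 2 * ((b * E₂ + c * F₃) / (c + b) - h)) +
      r * r * (1 / 2 * ((c * E₃ + c * F₃) / (c + c) - h))) =
    1 / 2 * (p * a * (p / (a + a) + q / (a + b) + r / (a + c)) * G₁ +
      q * b * (p / (a + b) + q / (b + b) + r / (b + c)) * G₂ +
      r * c * (p / (a + c) + q / (b + c) + r / (c + c)) * G₃) := by
  obtain rfl : F₁ = 2 * h + G₁ - E₁ := by linarith
  obtain rfl : F₂ = 2 * h + G₂ - E₂ := by linarith
  obtain rfl : F₃ = 2 * h + G₃ - E₃ := by linarith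
  rw [add_comm b a, add_comm c a, add_comm c b]
  have hab : a + b ≠ 0 := by positivity
  have hac : a + c ≠ 0 := by positivity
  have hbc : b + c ≠ 0 := by positivity
  have haa : a + a ≠ 0 := by positivity
  have hbb : b + b ≠ 0 := by positivity
  have hcc : c + c ≠ 0 := by positivity
  field_simp
  ring

/-- The bracket is the partial fraction expansion of `x² / ((x + a)(x + b)(x + c))` evaluated at `x
= a`. -/
theorem partial_fraction_coeff {a b c : ℝ} (ha : 0 < a) (hb : 0 < b) (hc : 0 < c) (hab : a ≠ b)
    (hac : a ≠ c) (hbc : b ≠ c) :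
    a ^ 2 / ((a - b) * (a - c)) * a * (a ^ 2 / ((a - b) * (a - c)) / (a + a) +
      b ^ 2 / ((b - a) * (b - c)) / (a + b) + c ^ 2 / ((c - a) * (c - b)) / (a + c)) =
    1 / 2 * (a ^ 4 / ((a ^ 2 - b ^ 2) * (a ^ 2 - c ^ 2))) := by
  have hab' := sub_ne_zero.2 hab
  have hac' := sub_ne_zero.2 hac
  have hbc' := sub_ne_zero.2 hbc
  have h1 : a + b ≠ 0 := by positivity
  have h2 : a + c ≠ 0 := by positivity
  have h3 : a + a ≠ 0 := by positivity
  rw [sq_sub_sq, sq_sub_sq, ← neg_sub a b, ← neg_sub a c, ← neg_sub b c]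
  field_simp
  ring

theorem autocovDistinct_rotate (α β γ σ H t : ℝ) :
    autocovDistinct γ α β σ H t = autocovDistinct α β γ σ H t := by
  unfold autocovDistinct
  rw [mul_comm (α ^ 2 - γ ^ 2), mul_comm (β ^ 2 - γ ^ 2)]
  ring

/-! ### Continuity of covariances in the rate. -/

section Stochastic

variable {Ω : Type*} [MeasurableSpace Ω] {P : Measure Ω}

theorem abs_integral_mul_le {f g : Ω → ℝ} (hf : MemLp f 2 P) (hg : MemLp g 2 P) {M : ℝ}
    (hfM : ∫ ω, f ω ^ 2 ∂P ≤ M) (hgM : ∫ ω, g ω ^ 2 ∂P ≤ M) : |∫ ω, f ω * g ω ∂P| ≤ M := by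
  have hi : Integrable (fun ω => 1 / 2 * (f ω ^ 2 + g ω ^ 2)) P :=
    (hf.integrable_sq.add hg.integrable_sq).const_mul _
  calc |∫ ω, f ω * g ω ∂P| ≤ ∫ ω, 1 / 2 * (f ω ^ 2 + g ω ^ 2) ∂P := by
        rw [← Real.norm_eq_abs]
        refine norm_integral_le_of_norm_le hi (Eventually.of_forall fun ω => ?_)
        rw [norm_mul, Real.norm_eq_abs, Real.norm_eq_abs, ← sq_abs (f ω), ← sq_abs (g ω)]
        nlinarith [sq_nonneg (|f ω| - |g ω|)]
    _ = 1 / 2 * (∫ ω, f ω ^ 2 ∂P + ∫ ω, g ω ^ 2 ∂P) := by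
        rw [integral_const_mul, integral_add hf.integrable_sq hg.integrable_sq]
    _ ≤ M := by linarith

/-- Autocovariances are transferred along `X = σ W`. -/
theorem IsSecondOrder.hasAutocovariance {W X : ℝ → Ω → ℝ} {R : ℝ → ℝ} {σ : ℝ}
    (hW : IsSecondOrder P W) (hX : ∀ᵐ ω ∂P, ∀ t, X t ω = σ * W t ω)
    (hR : ∀ s t, 0 ≤ t → σ ^ 2 * ∫ ω, W s ω * W (s + t) ω ∂P = R t) : HasAutocovariance P X R := by
  have hXt : ∀ t, X t =ᵐ[P] fun ω => σ * W t ω := fun t => hX.mono fun ω h => h t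
  refine ⟨fun s => (memLp_congr_ae (hXt s)).2 ((hW.memLp s).const_mul σ), fun s => ?_,
    fun s t ht => ?_⟩
  · rw [integral_congr_ae (hXt s), integral_const_mul, hW.centred, mul_zero]
  · rw [← hR s t ht, ← integral_const_mul]
    refine integral_congr_ae (hX.mono fun ω hω => ?_)
    simp only [hω]
    ring

variable [IsProbabilityMeasure P]

/-- The covariances of `T_γ Z` depend continuously on `γ`. -/
theorem tendsto_integral_ouTransform_mul {Z : ℝ → Ω → ℝ} (hZ : IsSecondOrder P Z)
    (htame : ∀ᵐ ω ∂P, Tame fun t => Z t ω) {α : ℝ} (hα : 0 < α) (s t : ℝ) :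
    Tendsto (fun γ => ∫ ω, ouTransform γ (fun r => Z r ω) s * ouTransform γ (fun r => Z r ω) t ∂P)
      (𝓝[≠] α)
      (𝓝 (∫ ω, ouTransform α (fun r => Z r ω) s * ouTransform α (fun r => Z r ω) t ∂P)) := by
  set X : ℝ → Ω → ℝ := fun t ω => ouTransform α (fun r => Z r ω) t with hX
  have hXs : IsSecondOrder P X := hZ.ouTransform hα
  obtain ⟨C, hC0, hC⟩ := hXs.growth
  -- A common second-moment bound at times `s` and `t`: the first summand serves `X = T_α Z`, the
  -- second `A_γ X` for every `γ > α / 2`.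
  set M : ℝ := (C + 2 * C * (1 + 2 / (α / 2) ^ 2)) * (1 + (s ^ 2 + t ^ 2)) with hM
  have hXM : ∀ r, r ^ 2 ≤ s ^ 2 + t ^ 2 → ∫ ω, X r ω ^ 2 ∂P ≤ M := by
    intro r hr
    refine (integral_sq_le_of_lintegral_le (hXs.memLp r).1 (by positivity) (hC r)).trans ?_
    rw [hM]
    gcongr
    exact le_add_of_nonneg_right (by positivity)
  have hs : s ^ 2 ≤ s ^ 2 + t ^ 2 := by nlinarith
  have ht : t ^ 2 ≤ s ^ 2 + t ^ 2 := by nlinarith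
  rw [tendsto_iff_norm_sub_tendsto_zero]
  have hlim : Tendsto (fun γ => |(γ - α) / γ| * (2 * M) + ((γ - α) / γ) ^ 2 * M) (𝓝[≠] α)
      (𝓝 0) := by
    have h1 : Tendsto (fun γ => (γ - α) / γ) (𝓝[≠] α) (𝓝 ((α - α) / α)) :=
      tendsto_nhdsWithin_of_tendsto_nhds
        ((tendsto_id.sub tendsto_const_nhds).div tendsto_id hα.ne')
    rw [sub_self, zero_div] at h1
    convert! (h1.abs.mul_const (2 * M)).add ((h1.pow 2).mul_const M) using 2
    simp
  refine squeeze_zero' (Eventually.of_forall fun _ => norm_nonneg _) ?_ hlim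
  have hev : ∀ᶠ γ in 𝓝[≠] α, α / 2 < γ :=
    (eventually_gt_nhds (half_lt_self hα)).filter_mono nhdsWithin_le_nhds
  filter_upwards [hev] with γ hγ
  have hγ0 : 0 < γ := (half_pos hα).trans hγ
  set A : ℝ → Ω → ℝ := fun t ω => expAvg γ (fun r => X r ω) t with hA
  have hAs : IsSecondOrder P A := hXs.expAvg hγ0
  have hAM : ∀ r, r ^ 2 ≤ s ^ 2 + t ^ 2 → ∫ ω, A r ω ^ 2 ∂P ≤ M := by
    intro r hr
    refine (integral_sq_le_of_lintegral_le (hAs.memLp r).1 (by positivity)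
      (hXs.lintegral_expAvg_le hC0 hC hγ0 r)).trans ?_
    rw [hM]
    gcongr
    exact le_add_of_nonneg_of_le hC0 (by gcongr)
  set ε := (γ - α) / γ with hε
  -- The resolvent identity makes `T_γ Z` a perturbation of `T_α Z` of size `(γ - α) / γ` with
  -- bounded second moments.
  have hdecomp : ∀ᵐ ω ∂P, ∀ r, ouTransform γ (fun r => Z r ω) r = X r ω - ε * A r ω := by
    filter_upwards [htame] with ω hω r
    have h1 := hω.ouTransform_ouTransform hγ0 hα r
    have h2 : ouTransform γ (ouTransform α fun t => Z t ω) r = X r ω - A r ω := rfl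
    have h3 : ouTransform α (fun t => Z t ω) r = X r ω := rfl
    rw [h2, h3] at h1
    rw [hε]
    field_simp
    linarith
  have i1 := (hXs.memLp s).integrable_mul (hXs.memLp t)
  have i2 := (hXs.memLp s).integrable_mul (hAs.memLp t)
  have i3 := (hAs.memLp s).integrable_mul (hXs.memLp t)
  have i4 := (hAs.memLp s).integrable_mul (hAs.memLp t)
  have hval : ∫ ω, ouTransform γ (fun r => Z r ω) s * ouTransform γ (fun r => Z r ω) t ∂P =
      ∫ ω, X s ω * X t ω ∂P - ε * ∫ ω, X s ω * A t ω ∂P +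
        (ε ^ 2 * ∫ ω, A s ω * A t ω ∂P - ε * ∫ ω, A s ω * X t ω ∂P) := by
    rw [← integral_const_mul, ← integral_const_mul, ← integral_const_mul]
    refine Eq.trans (integral_congr_ae ?_) (integral_sub_add_sub i1 (i2.const_mul ε)
      (i4.const_mul (ε ^ 2)) (i3.const_mul ε))
    filter_upwards [hdecomp] with ω hω
    simp only [hω]
    ring
  have b2 := abs_integral_mul_le (hXs.memLp s) (hAs.memLp t) (hXM s hs) (hAM t ht)
  have b3 := abs_integral_mul_le (hAs.memLp s) (hXs.memLp t) (hAM s hs) (hXM t ht)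
  have b4 := abs_integral_mul_le (hAs.memLp s) (hAs.memLp t) (hAM s hs) (hAM t ht)
  have hsub : ∫ ω, ouTransform γ (fun r => Z r ω) s * ouTransform γ (fun r => Z r ω) t ∂P -
      ∫ ω, X s ω * X t ω ∂P = -(ε * (∫ ω, X s ω * A t ω ∂P + ∫ ω, A s ω * X t ω ∂P)) +
        ε ^ 2 * ∫ ω, A s ω * A t ω ∂P := by
    rw [hval]; ring
  rw [hsub]
  refine (norm_add_le _ _).trans ?_
  rw [norm_neg, norm_mul, norm_mul, Real.norm_eq_abs, Real.norm_eq_abs, Real.norm_eq_abs,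
    Real.norm_eq_abs, abs_of_nonneg (sq_nonneg ε)]
  gcongr
  refine (abs_add_le _ _).trans ?_
  linarith

/-! ### The three autocovariances. -/

/-- A jointly measurable version of fractional Brownian motion. -/
structure IsFBMVersion (P : Measure Ω) (H : ℝ) (Y : ℝ → Ω → ℝ) : Prop where
  hurst_pos : 0 < H
  hurst_le_one : H ≤ 1
  secondOrder : IsSecondOrder P Y
  tame : ∀ᵐ ω ∂P, Tame fun t => Y t ω
  covariance : ∀ t s, ∫ ω, Y t ω * Y s ω ∂P =
    (1 / 2) * (|t| ^ (2 * H) + |s| ^ (2 * H) - |t - s| ^ (2 * H))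

namespace IsFBMVersion

variable {H : ℝ} {Y : ℝ → Ω → ℝ}

theorem integral_three (hY : IsFBMVersion P H Y) {a b c : ℝ} (ha : 0 < a) (hb : 0 < b) (hc : 0 < c)
    (hab : a ≠ b) (hac : a ≠ c) (hbc : b ≠ c) (s : ℝ) {τ : ℝ} (hτ : 0 ≤ τ) :
    ∫ ω, ouTransform a (ouTransform b (ouTransform c fun r => Y r ω)) s *
      ouTransform a (ouTransform b (ouTransform c fun r => Y r ω)) (s + τ) ∂P =
      autocovDistinct a b c 1 H τ := by
  have hH0 := hY.hurst_pos
  have hH1 := hY.hurst_le_one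
  set A : ℝ → ℝ → Ω → ℝ := fun l t ω => ouTransform l (fun r => Y r ω) t with hA
  set l : Fin 3 → ℝ := ![a, b, c] with hl
  set k : Fin 3 → ℝ := ![a ^ 2 / ((a - b) * (a - c)), b ^ 2 / ((b - a) * (b - c)),
    c ^ 2 / ((c - a) * (c - b))] with hk
  have hl0 : ∀ i, 0 < l i := by
    intro i
    fin_cases i <;> simpa [hl]
  have hsum : ∀ᵐ ω ∂P, ouTransform a (ouTransform b (ouTransform c fun r => Y r ω)) s *
      ouTransform a (ouTransform b (ouTransform c fun r => Y r ω)) (s + τ) =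
      ∑ i, ∑ j, k i * k j * (A (l i) s ω * A (l j) (s + τ) ω) := by
    filter_upwards [hY.tame] with ω hω
    rw [hω.ouTransform_three ha hb hc hab hac hbc, hω.ouTransform_three ha hb hc hab hac hbc]
    simp only [Fin.sum_univ_three, hk, hl, Matrix.cons_val, hA]
    ring
  have hint : ∀ i j, Integrable (fun ω => k i * k j * (A (l i) s ω * A (l j) (s + τ) ω)) P :=
    fun i j => (((hY.secondOrder.ouTransform (hl0 i)).memLp s).integrable_mul
      ((hY.secondOrder.ouTransform (hl0 j)).memLp (s + τ))).const_mul _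
  have hcov : ∀ i j, ∫ ω, A (l i) s ω * A (l j) (s + τ) ω ∂P =
      (1 / 2) * ((l j * expAvg (l j) (fun x => |x| ^ (2 * H)) τ +
        l i * ∫ u, |τ + u| ^ (2 * H) ∂expMeasure (l i)) / (l i + l j) - |τ| ^ (2 * H)) :=
    fun i j => integral_ouTransform_mul hH0 hH1 hY.secondOrder hY.tame hY.covariance
      (hl0 i) (hl0 j) s τ
  have hw1 := partial_fraction_coeff ha hb hc hab hac hbc
  have hw2 := partial_fraction_coeff hb ha hc hab.symm hbc hac
  have hw3 := partial_fraction_coeff hc ha hb hac.symm hbc.symm hab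
  rw [integral_congr_ae hsum, integral_finsetSum _ fun i _ => integrable_finsetSum _ fun j _ =>
    hint i j]
  simp only [integral_finsetSum _ fun j _ => hint _ j, integral_const_mul, hcov]
  simp only [Fin.sum_univ_three, hk, hl, Matrix.cons_val]
  rw [double_sum_partial_fractions ha hb hc _ _ _ _ _ _ _ _ _ _ _ _ _
    (expAvg_add_reflected_abs_rpow hH0 hH1 ha hτ) (expAvg_add_reflected_abs_rpow hH0 hH1 hb hτ)
    (expAvg_add_reflected_abs_rpow hH0 hH1 hc hτ), hw1]
  have e : ∀ x : ℝ, 0 < x → x ^ (4 - 2 * H) = x ^ 4 * x ^ (-(2 * H)) := fun x hx => by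
    have := rpow_sub_two_mul hx 4 H
    push_cast at this
    exact this
  rw [autocovDistinct, e a ha, e b hb, e c hc]
  linear_combination (1 / 2 * (2 * H * b ^ (-(2 * H)) * fH H (b * τ))) * hw2 +
    (1 / 2 * (2 * H * c ^ (-(2 * H)) * fH H (c * τ))) * hw3

theorem secondOrder_three (hY : IsFBMVersion P H Y) {a b c : ℝ} (ha : 0 < a) (hb : 0 < b)
    (hc : 0 < c) : IsSecondOrder P fun t ω =>
      ouTransform a (ouTransform b (ouTransform c fun r => Y r ω)) t :=
  ((hY.secondOrder.ouTransform hc).ouTransform hb).ouTransform ha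

/-- Perturb the outermost rate to `γ ≠ a, b`, where `integral_three` applies, and let `γ → a` on
both sides. -/
theorem integral_double (hY : IsFBMVersion P H Y) {a b : ℝ} (ha : 0 < a) (hb : 0 < b) (hab : a ≠ b)
    (s : ℝ) {τ : ℝ} (hτ : 0 ≤ τ) :
    ∫ ω, ouTransform a (ouTransform a (ouTransform b fun r => Y r ω)) s *
      ouTransform a (ouTransform a (ouTransform b fun r => Y r ω)) (s + τ) ∂P =
      autocovDouble a b 1 H τ := by
  refine tendsto_nhds_unique (tendsto_integral_ouTransform_mul
    ((hY.secondOrder.ouTransform hb).ouTransform ha)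
    (hY.tame.mono fun ω hω => (hω.ouTransform hb).ouTransform ha) ha s (s + τ)) ?_
  refine (tendsto_autocovDistinct hY.hurst_pos 1 ha hb hab hτ).congr' ?_
  have hpos : ∀ᶠ γ in 𝓝[≠] a, 0 < γ := (eventually_gt_nhds ha).filter_mono nhdsWithin_le_nhds
  have hne : ∀ᶠ γ in 𝓝[≠] a, γ ≠ b := (eventually_ne_nhds hab).filter_mono nhdsWithin_le_nhds
  filter_upwards [self_mem_nhdsWithin, hpos, hne] with γ hγa hγ hγb
  rw [← autocovDistinct_rotate]
  exact (hY.integral_three hγ ha hb hγa hγb hab s hτ).symm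

theorem integral_triple (hY : IsFBMVersion P H Y) {a : ℝ} (ha : 0 < a) (s : ℝ) {τ : ℝ}
    (hτ : 0 ≤ τ) :
    ∫ ω, ouTransform a (ouTransform a (ouTransform a fun r => Y r ω)) s *
      ouTransform a (ouTransform a (ouTransform a fun r => Y r ω)) (s + τ) ∂P =
      autocovTriple a 1 H τ := by
  refine tendsto_nhds_unique (tendsto_integral_ouTransform_mul
    ((hY.secondOrder.ouTransform ha).ouTransform ha)
    (hY.tame.mono fun ω hω => (hω.ouTransform ha).ouTransform ha) ha s (s + τ)) ?_
  refine (tendsto_autocovDouble hY.hurst_pos 1 ha hτ).congr' ?_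
  have hpos : ∀ᶠ γ in 𝓝[≠] a, 0 < γ := (eventually_gt_nhds ha).filter_mono nhdsWithin_le_nhds
  filter_upwards [self_mem_nhdsWithin, hpos] with γ hγa hγ
  rw [← hY.integral_double ha hγ (Ne.symm hγa) s hτ]
  refine integral_congr_ae (hY.tame.mono fun ω hω => ?_)
  simp only
  -- The perturbed rate is outermost here but innermost in `integral_double`, so it is commuted past
  -- both copies of `a`.
  rw [(hω.ouTransform ha).ouTransform_comm hγ ha, hω.ouTransform_comm hγ ha]

end IsFBMVersion

/-- A FOU process is obtained from a version of fractional Brownian motion by iterated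
transforms. -/
theorem IsFOU.exists_version {rates : List (ℝ × ℕ)} {σ H : ℝ} {X : ℝ → Ω → ℝ}
    (hX : IsFOU P rates σ H X) :
    ∃ Y : ℝ → Ω → ℝ, IsFBMVersion P H Y ∧ ∀ᵐ ω ∂P, ∀ t, X t ω =
      σ * (rates.flatMap fun q => List.replicate q.2 q.1).foldr ouTransform (fun r => Y r ω) t := by
  obtain ⟨B, hB, hXB⟩ := hX.exists_fbm
  obtain ⟨Y, hY, htame, hYB, hcov⟩ := hB.exists_version
  refine ⟨Y, ⟨hB.hurst_pos, hB.hurst_le_one, hY, htame, hcov⟩, ?_⟩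
  have hrs : ∀ r ∈ rates.flatMap fun q => List.replicate q.2 q.1, 0 < r := by
    intro r hr
    obtain ⟨q, hq, hrq⟩ := List.mem_flatMap.1 hr
    rw [List.eq_of_mem_replicate hrq]
    exact hX.rates_pos q hq
  filter_upwards [hXB, htame, hYB] with ω hω hωt hωY t
  simp only [← hωY] at hω
  have h := hω.eq_foldr hrs (hωt.const_mul σ)
  rw [foldr_ouTransform_const_mul] at h
  exact congrFun h t

end Stochastic

theorem proposition2 {Ω : Type*} [MeasurableSpace Ω] (P : Measure Ω) [IsProbabilityMeasure P]
    (σ H : ℝ) (hH0 : 0 < H) (hH1 : H ≤ 1) :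
    -- the derivatives of `f_H` used below exist
    ContDiffOn ℝ 2 (fH H) (Set.Ioi 0) ∧
    -- three distinct rates
    (∀ (α β γ : ℝ) (X : ℝ → Ω → ℝ), α ≠ β → α ≠ γ → β ≠ γ →
      IsFOU P [(α, 1), (β, 1), (γ, 1)] σ H X →
        HasAutocovariance P X (autocovDistinct α β γ σ H)) ∧
    -- a double rate and a simple rate
    (∀ (α β : ℝ) (X : ℝ → Ω → ℝ), α ≠ β →
      IsFOU P [(α, 2), (β, 1)] σ H X →
        HasAutocovariance P X (autocovDouble α β σ H)) ∧
    -- a triple rate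
    (∀ (α : ℝ) (X : ℝ → Ω → ℝ),
      IsFOU P [(α, 3)] σ H X →
        HasAutocovariance P X (autocovTriple α σ H)) ∧
    -- the repeated-rate formulas are the limits of the formulas with distinct rates
    (∀ α β t : ℝ, 0 < α → 0 < β → α ≠ β → 0 ≤ t →
      Tendsto (fun γ => autocovDistinct α β γ σ H t) (𝓝[≠] α) (𝓝 (autocovDouble α β σ H t))) ∧
    (∀ α t : ℝ, 0 < α → 0 ≤ t →
      Tendsto (fun β => autocovDouble α β σ H t) (𝓝[≠] α) (𝓝 (autocovTriple α σ H t))) := by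
  refine ⟨contDiffOn_fH hH0, fun α β γ X hαβ hαγ hβγ hX => ?_, fun α β X hαβ hX => ?_,
    fun α X hX => ?_, fun α β t hα hβ hαβ ht => tendsto_autocovDistinct hH0 σ hα hβ hαβ ht,
    fun α t hα ht => tendsto_autocovDouble hH0 σ hα ht⟩
  · have hα : 0 < α := hX.rates_pos (α, 1) (by simp)
    have hβ : 0 < β := hX.rates_pos (β, 1) (by simp)
    have hγ : 0 < γ := hX.rates_pos (γ, 1) (by simp)
    obtain ⟨Y, hY, hXY⟩ := hX.exists_version
    -- The flattened list of rates unfolds by definition to three nested transforms; `σ` enters only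
    -- through the factor `σ ^ 2`.
    refine (hY.secondOrder_three hα hβ hγ).hasAutocovariance hXY fun s t ht => ?_
    rw [hY.integral_three hα hβ hγ hαβ hαγ hβγ s ht, autocovDistinct, autocovDistinct]
    ring
  · have hα : 0 < α := hX.rates_pos (α, 2) (by simp)
    have hβ : 0 < β := hX.rates_pos (β, 1) (by simp)
    obtain ⟨Y, hY, hXY⟩ := hX.exists_version
    refine (hY.secondOrder_three hα hα hβ).hasAutocovariance hXY fun s t ht => ?_
    rw [hY.integral_double hα hβ hαβ s ht, autocovDouble, autocovDouble]
    ring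
  · have hα : 0 < α := hX.rates_pos (α, 3) (by simp)
    obtain ⟨Y, hY, hXY⟩ := hX.exists_version
    refine (hY.secondOrder_three hα hα hα).hasAutocovariance hXY fun s t ht => ?_
    rw [hY.integral_triple hα s ht, autocovTriple, autocovTriple]
    ring
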